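/- Let $M$ be a topological 2-sphere (a space homeomorphic to the standard unit sphere in $\mathbb{R}^3$), and let $G$ be a multigraph (loops and multiple edges are allowed). A topological embedding of $G$ in $M$ sends distinct vertices to distinct points and each edge to a continuous path between the images of its ends, injective on the open edge, so that the open edges are pairwise disjoint and contain no image of a vertex; its regions are the connected components of the complement of the image of $G$. The degree of a vertex is the number of edges incident with it, loops counted twice. Then $G$ is finite, has all vertex degrees at least $3$, and has a topological embedding in $M$ with exactly three regions, if and only if $G$ is one of the following: (i) a theta-graph: exactly two vertices and exactly three edges, each joining the two vertices; (ii) a figure-eight: exactly one vertex and exactly two edges, both of them loops; (iii) a bifocal: exactly two vertices and exactly three edges, namely one edge joining the two vertices and one loop at each of them. Moreover, every topological embedding of a theta-graph, a figure-eight or a bifocal in $M$ has exactly three regions. -/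

import Mathlib

open scoped Graph

namespace Graph

variable {α β : Type*}

/-- The degree of a vertex of a multigraph: the number of incident edges, where loops count twice. -/
noncomputable def vertexDegree (G : Graph α β) (x : α) : ℕ∞ :=
  {e | G.Inc e x}.encard + {e | G.IsLoopAt e x}.encard

/-- A theta-graph: exactly two vertices, joined by exactly three edges. -/
def IsThetaGraph (G : Graph α β) : Prop :=
  ∃ u v : α, u ≠ v ∧ V(G) = {u, v} ∧
    ∃ e f g : β, e ≠ f ∧ e ≠ g ∧ f ≠ g ∧ E(G) = {e, f, g} ∧
      G.IsLink e u v ∧ G.IsLink f u v ∧ G.IsLink g u v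

/-- A figure-eight graph: one vertex and exactly two edges, both of them loops. -/
def IsFigureEight (G : Graph α β) : Prop :=
  ∃ v : α, V(G) = {v} ∧
    ∃ e f : β, e ≠ f ∧ E(G) = {e, f} ∧ G.IsLoopAt e v ∧ G.IsLoopAt f v

/-- A bifocal graph: two vertices joined by one edge, with one loop at each of them. -/
def IsBifocal (G : Graph α β) : Prop :=
  ∃ u v : α, u ≠ v ∧ V(G) = {u, v} ∧
    ∃ e f g : β, e ≠ f ∧ e ≠ g ∧ f ≠ g ∧ E(G) = {e, f, g} ∧
      G.IsLoopAt e u ∧ G.IsLoopAt f v ∧ G.IsLink g u v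

/-- A topological embedding of a (finite) multigraph `G` in a space `M`: distinct vertices are sent
to distinct points, every edge is sent to a path between the images of its ends, and these paths
have no self-intersections, no intersections with one another, and no intersections with the
vertices other than those at the ends of the edges.
The values of `point` and `arc` outside the vertex set and the edge set are irrelevant. -/
structure TopEmbedding (G : Graph α β) (M : Type*) [TopologicalSpace M] where
  /-- The image of a vertex. -/
  point : α → M
  /-- The parametrized image of an edge. -/
  arc : β → C(unitInterval, M)
  point_injOn : Set.InjOn point V(G)
  arc_ends : ∀ e ∈ E(G), ∃ x y, G.IsLink e x y ∧ arc e 0 = point x ∧ arc e 1 = point y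
  arc_injOn : ∀ e ∈ E(G), Set.InjOn (arc e) (Set.Ioo 0 1)
  arc_ne_point : ∀ e ∈ E(G), ∀ x ∈ V(G), ∀ t ∈ Set.Ioo (0 : unitInterval) 1, arc e t ≠ point x
  arc_ne_arc : ∀ e ∈ E(G), ∀ f ∈ E(G), e ≠ f →
    ∀ s ∈ Set.Ioo (0 : unitInterval) 1, ∀ t ∈ Set.Ioo (0 : unitInterval) 1, arc e s ≠ arc f t

namespace TopEmbedding

variable {G : Graph α β} {M : Type*} [TopologicalSpace M]

/-- The subset of `M` covered by the embedded graph. -/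
def image (φ : G.TopEmbedding M) : Set M :=
  φ.point '' V(G) ∪ ⋃ e ∈ E(G), Set.range (φ.arc e)

/-- The regions of an embedded graph: the connected components of the complement of its image. -/
abbrev Region (φ : G.TopEmbedding M) : Type _ :=
  ConnectedComponents ↥(φ.image)ᶜ

/-- The embedded graph partitions the space into exactly `n` regions. -/
def PartitionsInto (φ : G.TopEmbedding M) (n : ℕ) : Prop :=
  ENat.card φ.Region = n

end TopEmbedding

end Graph

/-! The core is Euler's formula for topological embeddings: regions + vertices = 1 + components +
edges. For a graph with minimum degree 3 and three regions, handshaking gives 3V ≤ 2E, while Euler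
gives E = V + 2 - c with c ≥ 1. Hence V ≤ 2, and only (V, E) = (1, 2) and (2, 3) survive, both with
c = 1; degree bookkeeping then leaves the three graphs. Conversely each of these graphs is connected
with E = V + 1, so every embedding has three regions, and explicit plane drawings show that
embeddings exist.

The edges are merely continuous, so Euler's formula needs Jordan-type separation theorems. They are
obtained from Eilenberg's criterion: for compact `Y` in the plane, points `p` and `q` off `Y` lie in
the same component of the complement iff `(z - p) / (z - q)` has a continuous logarithm on `Y`
(`hasLogOn_div_of_joinedIn`, `JoinedIn.of_hasLogOn`). When an arc is attached to `X`, a logarithm on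
`X` and one along the arc can be matched at the start of the arc, and the only obstruction to gluing
is an integer jump at its end.

If the ends of the arc lie in different pieces of `X`, the jump is absorbed by shifting the
logarithm on one piece, so nothing is separated (`joinedIn_compl_union_range_of_separated`). In
general a combination of two quotients with jumps n and n' has no jump, so at most one region
splits, into at most two (`joinedIn_or_of_not_joinedIn`). If the ends are joined inside `X`, a
Janiszewski-type argument shows that a split does occur (`exists_not_joinedIn_compl_union_range`).

Building the drawing up from points and arcs gives Euler's formula in the plane (`EulerRelation`).
It passes to the sphere by stereographic projection from a point off the drawing, since restoring
that point leaves the number of regions unchanged (`regionCount_image`). -/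

open unitInterval Set Topology

/-! ### Continuous logarithms -/

/-- `f` has a continuous logarithm on `S`. -/
def HasLogOn {A : Type*} [TopologicalSpace A] (f : A → ℂ) (S : Set A) : Prop :=
  ∃ g : A → ℂ, ContinuousOn g S ∧ ∀ z ∈ S, Complex.exp (g z) = f z

namespace HasLogOn

variable {A : Type*} [TopologicalSpace A] {f f' : A → ℂ} {S T : Set A}

theorem mono (h : HasLogOn f S) (hT : T ⊆ S) : HasLogOn f T :=
  let ⟨g, hg, he⟩ := h
  ⟨g, hg.mono hT, fun z hz => he z (hT hz)⟩

theorem congr (h : HasLogOn f S) (hf : ∀ z ∈ S, f z = f' z) : HasLogOn f' S :=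
  let ⟨g, hg, he⟩ := h
  ⟨g, hg, fun z hz => (he z hz).trans (hf z hz)⟩

theorem mul (h : HasLogOn f S) (h' : HasLogOn f' S) : HasLogOn (fun z => f z * f' z) S := by
  obtain ⟨g, hg, he⟩ := h
  obtain ⟨g', hg', he'⟩ := h'
  exact ⟨fun z => g z + g' z, hg.add hg', fun z hz => by rw [Complex.exp_add, he z hz, he' z hz]⟩

theorem inv (h : HasLogOn f S) : HasLogOn (fun z => (f z)⁻¹) S := by
  obtain ⟨g, hg, he⟩ := h
  exact ⟨fun z => -g z, hg.neg, fun z hz => by rw [Complex.exp_neg, he z hz]⟩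

theorem zpow (h : HasLogOn f S) (n : ℤ) : HasLogOn (fun z => f z ^ n) S := by
  obtain ⟨g, hg, he⟩ := h
  exact ⟨fun z => n * g z, continuousOn_const.mul hg,
    fun z hz => by rw [Complex.exp_int_mul, he z hz]⟩

theorem prod {ι : Type*} {s : Finset ι} {f : ι → A → ℂ} (h : ∀ i ∈ s, HasLogOn (f i) S) :
    HasLogOn (fun z => ∏ i ∈ s, f i z) S := by
  classical
  induction s using Finset.induction_on with
  | empty => exact ⟨0, continuousOn_const, by simp⟩
  | insert i s hi ih =>
    exact ((h i (by simp)).mul (ih fun j hj => h j (by simp [hj]))).congr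
      fun z _ => by rw [Finset.prod_insert hi]

end HasLogOn

/-- Two continuous logarithms of the same function differ by a constant on a preconnected set. -/
theorem IsPreconnected.eq_of_exp_eq_one {A : Type*} [TopologicalSpace A] {S : Set A}
    (hS : IsPreconnected S) {d : A → ℂ} (hd : ContinuousOn d S)
    (h : ∀ z ∈ S, Complex.exp (d z) = 1) {a b : A} (ha : a ∈ S) (hb : b ∈ S) : d a = d b := by
  refine Complex.isCoveringMap_exp.constOn_of_comp hS hd ?_ ha hb
  intro a ha b hb
  simp [h a ha, h b hb]

/-- Homotopy lifting through the covering map `exp`, starting from the constant lift 0. -/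
theorem exists_log_of_homotopy {A : Type*} [TopologicalSpace A] (h : C(I × A, ℂ))
    (hne : ∀ x, h x ≠ 0) (h0 : ∀ a, h (0, a) = 1) :
    ∃ l : C(I × A, ℂ), ∀ x, Complex.exp (l x) = h x := by
  let H : C(I × A, {z : ℂ // z ≠ 0}) := ⟨fun x => ⟨h x, hne x⟩, by fun_prop⟩
  have H0 : ∀ a, H (0, a) = (fun z : ℂ => (⟨_, z.exp_ne_zero⟩ : {z : ℂ // z ≠ 0}))
      ((ContinuousMap.const A (0 : ℂ)) a) := by
    intro a
    simp [H, h0]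
  refine ⟨Complex.isCoveringMap_exp.liftHomotopy H (ContinuousMap.const A 0) H0, fun x => ?_⟩
  have := congrFun (Complex.isCoveringMap_exp.liftHomotopy_lifts H (ContinuousMap.const A 0) H0) x
  exact congrArg Subtype.val this

/-- A nowhere vanishing function on a contractible space has a continuous logarithm. -/
theorem exists_log_of_contraction {A : Type*} [TopologicalSpace A] (c : C(I × A, A)) (a₀ : A)
    (c0 : ∀ a, c (0, a) = a₀) (c1 : ∀ a, c (1, a) = a) (f : C(A, ℂ)) (hf : ∀ a, f a ≠ 0) :
    ∃ l : C(A, ℂ), ∀ a, Complex.exp (l a) = f a := by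
  -- Dividing by `f a₀` makes the homotopy start at 1; `log (f a₀)` is added back afterwards.
  obtain ⟨l, hl⟩ := exists_log_of_homotopy
    (⟨fun x => f (c x) / f a₀, by fun_prop (disch := simp [hf])⟩ : C(I × A, ℂ))
    (fun x => div_ne_zero (hf _) (hf _)) (fun a => by simp [c0, hf])
  refine ⟨⟨fun a => l (1, a) + Complex.log (f a₀), by fun_prop⟩, fun a => ?_⟩
  have := hf a₀
  simp [Complex.exp_add, hl, c1, Complex.exp_log this, this]

theorem Complex.exists_log_of_ne_zero (f : C(ℂ, ℂ)) (hf : ∀ a, f a ≠ 0) :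
    ∃ l : C(ℂ, ℂ), ∀ a, Complex.exp (l a) = f a :=
  exists_log_of_contraction ⟨fun x => (x.1 : ℝ) • x.2, by fun_prop⟩ 0 (by simp) (by simp) f hf

theorem unitInterval.exists_log_of_ne_zero (f : C(I, ℂ)) (hf : ∀ a, f a ≠ 0) :
    ∃ l : C(I, ℂ), ∀ a, Complex.exp (l a) = f a :=
  exists_log_of_contraction ⟨fun x => x.1 * x.2, by fun_prop⟩ 0 (by simp) (by simp) f hf

/-- Let the zero travel along a path in `S` from `q` to `p`: off `S`, the functions `(z - γ t) / (z
- q)` form a nowhere vanishing homotopy from 1 to the given quotient. -/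
theorem hasLogOn_div_of_joinedIn {S : Set ℂ} {p q : ℂ} (h : JoinedIn S p q) :
    HasLogOn (fun z => (z - p) / (z - q)) Sᶜ := by
  classical
  obtain ⟨γ, hγ⟩ := h.symm
  have hne : ∀ (z : ↥Sᶜ) t, (z : ℂ) - γ t ≠ 0 := fun z t h0 =>
    z.2 (by rw [sub_eq_zero.1 h0]; exact hγ t)
  have hq : ∀ (z : ↥Sᶜ), (z : ℂ) - q ≠ 0 := fun z => by simpa using hne z 0
  obtain ⟨l, hl⟩ := exists_log_of_homotopy
    (⟨fun x => ((x.2 : ℂ) - γ x.1) / (x.2 - q), by fun_prop (disch := simp [hq])⟩ : C(I × ↥Sᶜ, ℂ))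
    (fun x => div_ne_zero (hne _ _) (hq _)) (fun a => by simp [hq])
  refine ⟨fun z => if hz : z ∈ Sᶜ then l (1, ⟨z, hz⟩) else 0, ?_, fun z hz => ?_⟩
  · rw [continuousOn_iff_continuous_domRestrict]
    have : Continuous fun z : ↥Sᶜ => l (1, z) := by fun_prop
    refine this.congr fun z => ?_
    rw [domRestrict_apply, dif_pos z.2]
  · simp only [dif_pos hz, hl]
    simp

/-- Along the circle a logarithm of `z ^ m` differs from `m (log R + iθ)` by a constant; the former
returns to its value after a full turn, the latter gains `2πim`. -/
theorem not_hasLogOn_zpow_sphere {R : ℝ} (hR : 0 < R) {m : ℤ} (hm : m ≠ 0) :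
    ¬ HasLogOn (fun z : ℂ => z ^ m) (Metric.sphere 0 R) := by
  rintro ⟨g, hg, he⟩
  let c : ℝ → ℂ := circleMap 0 R
  have hc : ∀ θ, c θ ∈ Metric.sphere (0 : ℂ) R := circleMap_mem_sphere 0 hR.le
  have hcc : Continuous c := continuous_circleMap 0 R
  have hgc : Continuous fun θ => g (c θ) := hg.comp_continuous hcc hc
  have hR' : (R : ℂ) ≠ 0 := by exact_mod_cast hR.ne'
  have key := (isPreconnected_univ (α := ℝ)).eq_of_exp_eq_one
    (d := fun θ => g (c θ) - m * (Complex.log R + θ * Complex.I)) (by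
      rw [continuousOn_univ]
      exact hgc.sub (by fun_prop)) (fun θ _ => by
      rw [Complex.exp_sub, he _ (hc θ), Complex.exp_int_mul, Complex.exp_add,
        Complex.exp_log hR']
      have : c θ = R * Complex.exp (θ * Complex.I) := by simp [c, circleMap]
      rw [this, div_self]
      exact zpow_ne_zero _ (mul_ne_zero hR' (Complex.exp_ne_zero _))) (mem_univ 0)
      (mem_univ (2 * Real.pi))
  have h2 : c (2 * Real.pi) = c 0 := by simp [c, circleMap]
  simp only [h2] at key
  have hpi : (Real.pi : ℂ) ≠ 0 := by exact_mod_cast Real.pi_ne_zero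
  have : (m : ℂ) * ((2 * Real.pi : ℝ) * Complex.I) = 0 := by
    push_cast at key ⊢
    linear_combination key
  simp [hm, hpi] at this

/-- The total multiplicity, in an open bounded set whose frontier lies in `Y`, of a product of
linear factors which has a continuous logarithm on `Y`, is zero. -/
theorem sum_eq_zero_of_hasLogOn {ι : Type*} [Fintype ι] {Y U : Set ℂ} (hU : IsOpen U)
    (hUb : Bornology.IsBounded U) (hY : IsClosed Y) (hfr : frontier U ⊆ Y) (p : ι → ℂ) (m : ι → ℤ)
    (hp : ∀ i, p i ∉ Y) (hlog : HasLogOn (fun z => ∏ i, (z - p i) ^ m i) Y)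
    [DecidablePred fun i => p i ∈ U] :
    ∑ i with p i ∈ U, m i = 0 := by
  classical
  obtain ⟨g, hg, he⟩ := hlog
  -- Tietze extends the logarithm from `Y` to the whole plane; its exponential equals the product
  -- only on `Y`.
  obtain ⟨G, hG⟩ := ContinuousMap.exists_restrict_eq hY ⟨Y.domRestrict g, hg.domRestrict⟩
  have hG' : ∀ z ∈ Y, G z = g z := fun z hz => congrArg (fun F => F ⟨z, hz⟩) hG
  let fin : ℂ → ℂ := fun z => ∏ i with p i ∈ U, (z - p i) ^ m i
  let fout : ℂ → ℂ := fun z => ∏ i with p i ∉ U, (z - p i) ^ m i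
  have hmul : ∀ z, fin z * fout z = ∏ i, (z - p i) ^ m i := fun z =>
    Finset.prod_filter_mul_prod_filter_not ..
  have hfin0 : ∀ z, z ∉ U → fin z ≠ 0 := by
    intro z hz
    refine Finset.prod_ne_zero_iff.2 fun i hi => zpow_ne_zero _ (sub_ne_zero.2 ?_)
    rintro rfl
    exact hz (Finset.mem_filter.1 hi).2
  have hclU : closure U ⊆ U ∪ Y := by
    rw [closure_eq_self_union_frontier]
    exact union_subset_union_right _ hfr
  have hfout0 : ∀ z, z ∈ closure U → fout z ≠ 0 := by
    intro z hz
    refine Finset.prod_ne_zero_iff.2 fun i hi => zpow_ne_zero _ (sub_ne_zero.2 ?_)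
    rintro rfl
    exact (hclU hz).elim (Finset.mem_filter.1 hi).2 (hp i)
  have hfinc : ContinuousOn fin Uᶜ := by
    refine continuousOn_finsetProd _ fun i hi => ContinuousOn.zpow₀ (by fun_prop) _ ?_
    intro z hz
    refine Or.inl (sub_ne_zero.2 ?_)
    rintro rfl
    exact hz (Finset.mem_filter.1 hi).2
  have hfoutc : ContinuousOn fout (closure U) := by
    refine continuousOn_finsetProd _ fun i hi => ContinuousOn.zpow₀ (by fun_prop) _ ?_
    intro z hz
    refine Or.inl (sub_ne_zero.2 ?_)
    rintro rfl
    exact (hclU hz).elim (Finset.mem_filter.1 hi).2 (hp i)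
  -- On the frontier of `U`, contained in `Y`, one has `exp G = fin * fout`, so the two formulas
  -- agree. Thus `K` is a nowhere vanishing continuous extension of `1 / fin` from the complement of
  -- `U` to the plane, and has a logarithm there.
  let K : ℂ → ℂ := (closure U).piecewise (fun z => fout z * Complex.exp (-G z)) fun z => (fin z)⁻¹
  have hKeq : ∀ z ∈ Uᶜ, K z = (fin z)⁻¹ := by
    intro z hz
    by_cases hzc : z ∈ closure U
    · have hzY : z ∈ Y := (hclU hzc).resolve_left hz
      have h1 : _ = ∏ i, (z - p i) ^ m i := he z hzY
      simp only [K, piecewise_eq_of_mem _ _ _ hzc]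
      rw [← hmul] at h1
      rw [Complex.exp_neg, hG' z hzY, h1]
      have h2 := hfin0 z hz
      have h3 := hfout0 z hzc
      field_simp
    · simp only [K, piecewise_eq_of_notMem _ _ _ hzc]
  have hKc : Continuous K := by
    rw [← continuousOn_univ, ← union_compl_self U]
    have h1 : ContinuousOn K (closure U) :=
      (hfoutc.mul (by fun_prop)).congr (piecewise_eqOn _ _ _)
    have h2 : ContinuousOn K Uᶜ := (hfinc.inv₀ fun z hz => hfin0 z hz).congr hKeq
    exact (h1.union_of_isClosed h2 isClosed_closure hU.isClosed_compl).mono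
      (union_subset_union_left _ subset_closure)
  have hK0 : ∀ z, K z ≠ 0 := by
    intro z
    by_cases hz : z ∈ U
    · have hzc := subset_closure hz
      simp only [K, piecewise_eq_of_mem _ _ _ hzc]
      exact mul_ne_zero (hfout0 z hzc) (Complex.exp_ne_zero _)
    · rw [hKeq z hz]
      exact inv_ne_zero (hfin0 z hz)
  obtain ⟨l, hl⟩ := Complex.exists_log_of_ne_zero ⟨K, hKc⟩ hK0
  have hfinlog : HasLogOn fin Uᶜ := by
    refine (HasLogOn.inv ⟨l, l.continuous.continuousOn, fun z hz => ?_⟩ :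
      HasLogOn (fun z => (K z)⁻¹) Uᶜ).congr fun z hz => ?_
    · exact hl z
    · rw [hKeq z hz, inv_inv]
  obtain ⟨R, hR, hUR⟩ : ∃ R > 0, U ⊆ Metric.ball 0 R := by
    obtain ⟨R, hR⟩ := hUb.subset_ball 0
    exact ⟨max R 1, by positivity, hR.trans (Metric.ball_subset_ball (le_max_left _ _))⟩
  by_contra hsum
  refine not_hasLogOn_zpow_sphere hR hsum ?_
  have hsph : Metric.sphere (0 : ℂ) R ⊆ (Metric.ball 0 R)ᶜ := fun z hz => by
    simp only [mem_sphere_iff_norm, sub_zero] at hz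
    simp [hz]
  -- On a large circle `fin` differs from a power of `z` by factors `(z - p i) / z`, each with a
  -- logarithm because `p i` and 0 are joined inside the ball. The exponent is the sum in question.
  have h3 : HasLogOn (fun z => ∏ i with p i ∈ U, ((z - p i) / (z - 0)) ^ m i)
      (Metric.sphere 0 R) := by
    refine HasLogOn.prod fun i hi => HasLogOn.zpow (HasLogOn.mono (hasLogOn_div_of_joinedIn ?_) hsph) _
    exact ((convex_ball (0 : ℂ) R).isPathConnected ⟨0, by simpa⟩).joinedIn _
      (hUR (Finset.mem_filter.1 hi).2) _ (by simpa)
  refine ((hfinlog.mono (hsph.trans (compl_subset_compl.2 hUR))).mul h3.inv).congr fun z hz => ?_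
  have hz0 : z ≠ 0 := by
    rintro rfl
    simp at hz
    exact hR.ne hz
  have hf := hfin0 z fun h => hsph hz (hUR h)
  simp only [sub_zero, div_zpow, Finset.prod_div_distrib]
  rw [inv_div, ← mul_div_assoc, mul_comm, mul_div_assoc]
  change _ * (fin z / fin z) = _
  rw [div_self hf, mul_one]
  generalize (Finset.univ.filter fun i => p i ∈ U) = s
  induction s using Finset.induction_on with
  | empty => simp
  | insert i s hi ih => rw [Finset.prod_insert hi, Finset.sum_insert hi, zpow_add₀ hz0, ih]

theorem isPathConnected_compl_closedBall_zero {R : ℝ} (hR : 0 ≤ R) :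
    IsPathConnected (Metric.closedBall (0 : ℂ) R)ᶜ := by
  have h1 : IsPathConnected (Ioi R ×ˢ Metric.sphere (0 : ℂ) 1) :=
    ((convex_Ioi R).isPathConnected ⟨R + 1, by simp⟩).prod
      (isPathConnected_sphere (by simp) 0 zero_le_one)
  convert h1.image (f := fun x : ℝ × ℂ => (x.1 : ℂ) * x.2) (by fun_prop) using 1
  ext z
  simp only [mem_compl_iff, Metric.mem_closedBall, dist_zero_right, not_le, mem_image, mem_prod,
    mem_Ioi, mem_sphere_iff_norm, sub_zero, Prod.exists]
  constructor
  · intro h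
    have hz : ‖z‖ ≠ 0 := (hR.trans_lt h).ne'
    have hz' : (‖z‖ : ℂ) ≠ 0 := by exact_mod_cast hz
    exact ⟨‖z‖, z / ‖z‖, ⟨h, by simp [hz]⟩, by field_simp⟩
  · rintro ⟨r, u, ⟨hr, hu⟩, rfl⟩
    rw [norm_mul, hu, mul_one, Complex.norm_real, Real.norm_eq_abs]
    exact lt_of_lt_of_le hr (le_abs_self r)

/-! ### Degrees in complementary components and Eilenberg's criterion -/

section Saturated

variable {Y U : Set ℂ}

theorem isOpen_of_joinedIn_saturated (hY : IsClosed Y) (hUY : U ⊆ Yᶜ)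
    (hU : ∀ z ∈ U, ∀ w, JoinedIn Yᶜ z w → w ∈ U) : IsOpen U := by
  rw [isOpen_iff_mem_nhds]
  intro z hz
  exact Filter.mem_of_superset ((hY.isOpen_compl.pathComponentIn z).mem_nhds
    (mem_pathComponentIn_self (hUY hz))) fun w hw => hU z hz w hw

theorem frontier_subset_of_joinedIn_saturated (hY : IsClosed Y) (hUY : U ⊆ Yᶜ)
    (hU : ∀ z ∈ U, ∀ w, JoinedIn Yᶜ z w → w ∈ U) : frontier U ⊆ Y := by
  intro z hz
  by_contra hzY
  obtain ⟨w, hw, hwU⟩ := mem_closure_iff_nhds.1 hz.1 _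
    ((hY.isOpen_compl.pathComponentIn z).mem_nhds (mem_pathComponentIn_self hzY))
  exact hz.2 ((isOpen_of_joinedIn_saturated hY hUY hU).interior_eq.symm ▸
    hU w hwU z (JoinedIn.symm hw))

/-- If a product of linear factors of total degree zero has a continuous logarithm on the compact
set `Y`, then its degree in each component of the complement of `Y` is zero. -/
theorem sum_joinedIn_eq_zero_of_hasLogOn {ι : Type*} [Fintype ι] (hY : IsCompact Y) (p : ι → ℂ)
    (m : ι → ℤ) (hm : ∑ i, m i = 0) (hp : ∀ i, p i ∉ Y)
    (hlog : HasLogOn (fun z => ∏ i, (z - p i) ^ m i) Y) (c : ℂ)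
    [DecidablePred fun i => JoinedIn Yᶜ c (p i)] :
    ∑ i with JoinedIn Yᶜ c (p i), m i = 0 := by
  classical
  obtain ⟨R, hR0, hR⟩ : ∃ R : ℝ, 0 ≤ R ∧ Y ⊆ Metric.closedBall 0 R := by
    obtain ⟨R, hR⟩ := hY.isBounded.subset_closedBall 0
    exact ⟨max R 0, le_max_right _ _, hR.trans (Metric.closedBall_subset_closedBall (le_max_left _ _))⟩
  let W := {z | JoinedIn Yᶜ c z}
  have hWY : W ⊆ Yᶜ := fun z hz => hz.target_mem
  have hW : ∀ z ∈ W, ∀ w, JoinedIn Yᶜ z w → w ∈ W := fun z hz w hw => hz.trans hw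
  by_cases hb : W ⊆ Metric.closedBall 0 R
  · exact sum_eq_zero_of_hasLogOn (isOpen_of_joinedIn_saturated hY.isClosed hWY hW)
      (Metric.isBounded_closedBall.subset hb) hY.isClosed
      (frontier_subset_of_joinedIn_saturated hY.isClosed hWY hW) p m hp hlog
  -- The component reaches outside the ball, whose exterior is path-connected, so all other
  -- components lie in the ball. Their total degree vanishes, and the full total is zero.
  · obtain ⟨w, hw, hwR⟩ := not_subset.1 hb
    have hVY : Yᶜ \ W ⊆ Yᶜ := sdiff_subset
    have hV : ∀ z ∈ Yᶜ \ W, ∀ w, JoinedIn Yᶜ z w → w ∈ Yᶜ \ W := fun z hz w hw =>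
      ⟨hw.target_mem, fun h => hz.2 (JoinedIn.trans h hw.symm)⟩
    have hVb : Yᶜ \ W ⊆ Metric.closedBall 0 R := by
      intro z hz
      by_contra hzR
      exact hz.2 (hW w hw z (((isPathConnected_compl_closedBall_zero hR0).joinedIn w hwR z hzR).mono
        (compl_subset_compl.2 hR)))
    have h0 := sum_eq_zero_of_hasLogOn (isOpen_of_joinedIn_saturated hY.isClosed hVY hV)
      (Metric.isBounded_closedBall.subset hVb) hY.isClosed
      (frontier_subset_of_joinedIn_saturated hY.isClosed hVY hV) p m hp hlog
    rw [← Finset.sum_filter_add_sum_filter_not _ fun i => JoinedIn Yᶜ c (p i)] at hm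
    convert hm using 1
    rw [left_eq_add]
    convert h0 using 2
    ext i
    simp [W, hp i]

end Saturated

variable {X Y : Set ℂ}

/-- Otherwise the component of `p` would contain the zero but not the pole, and have degree 1. -/
theorem JoinedIn.of_hasLogOn (hY : IsCompact Y) {p q : ℂ} (hp : p ∉ Y) (hq : q ∉ Y)
    (h : HasLogOn (fun z => (z - p) / (z - q)) Y) : JoinedIn Yᶜ p q := by
  classical
  by_contra hpq
  have := sum_joinedIn_eq_zero_of_hasLogOn hY ![p, q] ![1, -1] (by simp)
    (by simp [Fin.forall_fin_two, hp, hq])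
    (h.congr fun z _ => by simp [Fin.prod_univ_two, div_eq_mul_inv]) p
  rw [Finset.sum_filter, Fin.sum_univ_two] at this
  simp [hpq, JoinedIn.refl (show p ∈ Yᶜ from hp)] at this

/-- The degrees at `p, q, p', q'` are `n', -n', -n, n`. Since `p` and `q` are in different
components, the nonzero contribution of each must be cancelled by `p'` or `q'`. -/
theorem joinedIn_or_of_hasLogOn (hY : IsCompact Y) {p q p' q' : ℂ} (hp : p ∉ Y) (hq : q ∉ Y)
    (hp' : p' ∉ Y) (hq' : q' ∉ Y) {n n' : ℤ} (hn' : n' ≠ 0) (hpq : ¬ JoinedIn Yᶜ p q)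
    (h : HasLogOn (fun z => ((z - p) / (z - q)) ^ n' * ((z - p') / (z - q')) ^ (-n)) Y) :
    (JoinedIn Yᶜ p p' ∨ JoinedIn Yᶜ p q') ∧ (JoinedIn Yᶜ q p' ∨ JoinedIn Yᶜ q q') := by
  classical
  have key := sum_joinedIn_eq_zero_of_hasLogOn hY ![p, q, p', q'] ![n', -n', -n, n]
    (by simp [Fin.sum_univ_four]) (by
      intro i
      fin_cases i <;> simpa)
    (h.congr fun z _ => by
      simp only [Fin.prod_univ_four, div_zpow, zpow_neg, inv_div]
      simp [div_eq_mul_inv]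
      ring)
  have hqp : ¬ JoinedIn Yᶜ q p := fun h => hpq h.symm
  constructor
  · by_contra! hcon
    have := key p
    rw [Finset.sum_filter, Fin.sum_univ_four] at this
    simp [hpq, hcon, JoinedIn.refl (show p ∈ Yᶜ from hp), hn'] at this
  · by_contra! hcon
    have := key q
    rw [Finset.sum_filter, Fin.sum_univ_four] at this
    simp [hqp, hcon, JoinedIn.refl (show q ∈ Yᶜ from hq), hn'] at this

/-! ### Attaching an arc to a compact set -/

/-- Continuous logarithms on `X` and along an arc which agree at the ends of the arc give a
continuous logarithm on the union. -/
theorem hasLogOn_union_range (hX : IsClosed X) {γ : C(I, ℂ)} (hγ : Function.Injective γ)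
    (hγX : ∀ t ∈ Ioo (0 : I) 1, γ t ∉ X) {f g : ℂ → ℂ} (hg : ContinuousOn g X)
    (he : ∀ z ∈ X, Complex.exp (g z) = f z) {l : C(I, ℂ)}
    (hl : ∀ t, Complex.exp (l t) = f (γ t)) (h0 : l 0 = g (γ 0)) (h1 : l 1 = g (γ 1)) :
    HasLogOn f (X ∪ range γ) := by
  classical
  have hemb := γ.continuous.isClosedEmbedding hγ
  -- Transport `l` to the closed arc and extend it by Tietze. The arc meets `X` at most at its ends,
  -- where `G` and `g` agree.
  obtain ⟨G, hG⟩ := ContinuousMap.exists_extension hemb l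
  have hG' : ∀ t, G (γ t) = l t := fun t => congrArg (fun F => F t) hG
  have hr : EqOn (X.piecewise g G) G (range γ) := by
    rintro _ ⟨t, rfl⟩
    by_cases ht : γ t ∈ X
    · rw [piecewise_eq_of_mem _ _ _ ht, hG']
      rcases eq_or_ne t 0 with rfl | ht0
      · exact h0.symm
      rcases eq_or_ne t 1 with rfl | ht1
      · exact h1.symm
      · exact absurd ht (hγX t ⟨unitInterval.pos_iff_ne_zero.2 ht0, unitInterval.lt_one_iff_ne_one.2 ht1⟩)
    · rw [piecewise_eq_of_notMem _ _ _ ht]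
  refine ⟨X.piecewise g G, ?_, ?_⟩
  · exact (hg.congr (piecewise_eqOn _ _ _)).union_of_isClosed (G.continuous.continuousOn.congr hr)
      hX hemb.isClosed_range
  · rintro z (hz | ⟨t, rfl⟩)
    · rw [piecewise_eq_of_mem _ _ _ hz, he z hz]
    · rw [hr (mem_range_self t), hG', hl]

/-- The two logarithms of `(z - p) / (z - q)`, on `X` and along an arc, that agree at the start
of the arc. -/
theorem exists_log_arc {p q : ℂ} (hpq : JoinedIn Xᶜ p q) {γ : C(I, ℂ)} (h0 : γ 0 ∈ X)
    (h1 : γ 1 ∈ X) (hp : p ∉ range γ) (hq : q ∉ range γ) :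
    ∃ (g : ℂ → ℂ) (l : C(I, ℂ)) (n : ℤ), ContinuousOn g X ∧
      (∀ z ∈ X, Complex.exp (g z) = (z - p) / (z - q)) ∧
      (∀ t, Complex.exp (l t) = (γ t - p) / (γ t - q)) ∧ l 0 = g (γ 0) ∧
      l 1 = g (γ 1) + n * (2 * Real.pi * Complex.I) := by
  obtain ⟨g, hg, he⟩ := hasLogOn_div_of_joinedIn hpq
  rw [compl_compl] at hg he
  have hne : ∀ {r}, r ∉ range γ → ∀ t, γ t - r ≠ 0 := fun hr t h =>
    hr ⟨t, sub_eq_zero.1 h⟩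
  obtain ⟨l, hl⟩ := unitInterval.exists_log_of_ne_zero
    ⟨fun t => (γ t - p) / (γ t - q), Continuous.div (by fun_prop) (by fun_prop) (hne hq)⟩
    (fun t => div_ne_zero (hne hp t) (hne hq t))
  simp only [ContinuousMap.coe_mk] at hl
  have key : ∀ t, γ t ∈ X → Complex.exp (l t - g (γ t)) = 1 := fun t ht => by
    rw [Complex.exp_sub, hl, he _ ht, div_self]
    exact div_ne_zero (hne hp t) (hne hq t)
  obtain ⟨k, hk⟩ := Complex.exp_eq_one_iff.1 (key 0 h0)
  obtain ⟨n, hn⟩ := Complex.exp_eq_one_iff.1 (key 1 h1)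
  -- Shifting `g` by the mismatch `k` at the start leaves `n - k` as the jump at the end.
  refine ⟨fun z => g z + k * (2 * Real.pi * Complex.I), l, n - k, by fun_prop, fun z hz => ?_,
    hl, ?_, ?_⟩
  · rw [Complex.exp_add, he z hz, Complex.exp_int_mul_two_pi_mul_I, mul_one]
  · linear_combination hk
  · push_cast
    linear_combination hn

variable {γ : C(I, ℂ)}

/-- An arc joining two points of different pieces of `X` separates no points. -/
theorem joinedIn_compl_union_range_of_separated (hX : IsCompact X) (hγ : Function.Injective γ)
    (hγX : ∀ t ∈ Ioo (0 : I) 1, γ t ∉ X) {S T : Set ℂ} (hS : IsClosed S) (hT : IsClosed T)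
    (hST : Disjoint S T) (hX' : X = S ∪ T) (h0 : γ 0 ∈ S) (h1 : γ 1 ∈ T) {p q : ℂ}
    (hp : p ∉ X ∪ range γ) (hq : q ∉ X ∪ range γ) (hpq : JoinedIn Xᶜ p q) :
    JoinedIn (X ∪ range γ)ᶜ p q := by
  classical
  refine .of_hasLogOn (hX.union (isCompact_range γ.continuous)) hp hq ?_
  obtain ⟨g, l, n, hg, he, hl, hl0, hl1⟩ := exists_log_arc hpq (hX' ▸ Or.inl h0) (hX' ▸ Or.inr h1)
    (fun h => hp (Or.inr h)) (fun h => hq (Or.inr h))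
  have hTS : ∀ z ∈ T, z ∉ S := fun z hz hz' => hST.le_bot ⟨hz', hz⟩
  have hr : EqOn (S.piecewise g fun z => g z + n * (2 * Real.pi * Complex.I))
      (fun z => g z + n * (2 * Real.pi * Complex.I)) T := fun z hz =>
    piecewise_eq_of_notMem _ _ _ (hTS z hz)
  have hl : EqOn (S.piecewise g fun z => g z + n * (2 * Real.pi * Complex.I)) g S :=
    piecewise_eqOn _ _ _
  have hgS : ContinuousOn g S := hg.mono (hX' ▸ subset_union_left)
  have hgT : ContinuousOn g T := hg.mono (hX' ▸ subset_union_right)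
  -- Since `S` and `T` are disjoint and closed, adding the jump on `T` alone keeps the logarithm
  -- continuous and makes it match the arc at both ends.
  refine hasLogOn_union_range hX.isClosed hγ hγX
    (g := S.piecewise g fun z => g z + n * (2 * Real.pi * Complex.I)) (l := l) ?_ ?_ ‹_› ?_ ?_
  · rw [hX']
    exact (hgS.congr hl).union_of_isClosed ((hgT.add continuousOn_const).congr hr) hS hT
  · intro z hz
    by_cases hzS : z ∈ S
    · rw [piecewise_eq_of_mem _ _ _ hzS, he z hz]
    · rw [piecewise_eq_of_notMem _ _ _ hzS, Complex.exp_add, he z hz,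
        Complex.exp_int_mul_two_pi_mul_I, mul_one]
  · rw [hl h0, hl0]
  · rw [hr h1, hl1]

/-- An arc with ends in `X` splits at most one component of the complement of `X`, and that one
into at most two. -/
theorem joinedIn_or_of_not_joinedIn (hX : IsCompact X) (hγ : Function.Injective γ)
    (hγX : ∀ t ∈ Ioo (0 : I) 1, γ t ∉ X) (h0 : γ 0 ∈ X) (h1 : γ 1 ∈ X) {p q p' q' : ℂ}
    (hp : p ∉ X ∪ range γ) (hq : q ∉ X ∪ range γ) (hp' : p' ∉ X ∪ range γ)
    (hq' : q' ∉ X ∪ range γ) (hpq : JoinedIn Xᶜ p q) (hpq' : JoinedIn Xᶜ p' q')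
    (hn : ¬ JoinedIn (X ∪ range γ)ᶜ p q) (hn' : ¬ JoinedIn (X ∪ range γ)ᶜ p' q') :
    (JoinedIn (X ∪ range γ)ᶜ p p' ∨ JoinedIn (X ∪ range γ)ᶜ p q') ∧
      (JoinedIn (X ∪ range γ)ᶜ q p' ∨ JoinedIn (X ∪ range γ)ᶜ q q') := by
  have hY : IsCompact (X ∪ range γ) := hX.union (isCompact_range γ.continuous)
  obtain ⟨g, l, n, hg, he, hl, hl0, hl1⟩ := exists_log_arc hpq h0 h1
    (fun h => hp (Or.inr h)) (fun h => hq (Or.inr h))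
  obtain ⟨g', l', n', hg', he', hl', hl0', hl1'⟩ := exists_log_arc hpq' h0 h1
    (fun h => hp' (Or.inr h)) (fun h => hq' (Or.inr h))
  -- With zero jump the logarithms would glue, and `p'`, `q'` would not be separated.
  have hn0' : n' ≠ 0 := by
    rintro rfl
    exact hn' (.of_hasLogOn hY hp' hq'
      (hasLogOn_union_range hX.isClosed hγ hγX hg' he' hl' hl0' (by simpa using hl1')))
  refine joinedIn_or_of_hasLogOn hY hp hq hp' hq' (n := n) hn0' hn ?_
  -- The combined jump at the end of the arc is `n' * n - n * n' = 0`.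
  refine hasLogOn_union_range hX.isClosed hγ hγX (g := fun z => n' * g z + (-n : ℤ) * g' z)
    (l := ⟨fun t => n' * l t + (-n : ℤ) * l' t, by fun_prop⟩) (by fun_prop) ?_ ?_ ?_ ?_
  · intro z hz
    rw [Complex.exp_add, Complex.exp_int_mul, Complex.exp_int_mul, he z hz, he' z hz]
  · intro t
    rw [ContinuousMap.coe_mk, Complex.exp_add, Complex.exp_int_mul, Complex.exp_int_mul, hl, hl']
  · simp [hl0, hl0']
  · simp [hl1, hl1']
    ring

/-- An arc joining two points of `X` that are joined by a path in `X` separates the complement. -/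
theorem exists_not_joinedIn_compl_union_range (hX : IsCompact X) (hXY : X ∩ range γ ⊆ {γ 0, γ 1})
    (hne : γ 0 ≠ γ 1) (hjoin : JoinedIn X (γ 0) (γ 1)) (hint : interior (X ∪ range γ) = ∅) :
    ∃ p ∉ X ∪ range γ, ∃ q ∉ X ∪ range γ,
      JoinedIn Xᶜ p q ∧ ¬ JoinedIn (X ∪ range γ)ᶜ p q := by
  classical
  by_contra! hcon
  set a := γ 0
  set b := γ 1
  have hA : IsCompact (range γ) := isCompact_range γ.continuous
  have hY : IsCompact (X ∪ range γ) := hX.union hA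
  have hjoin' : JoinedIn (range γ) a b := ⟨⟨γ, rfl, rfl⟩, fun t => mem_range_self t⟩
  obtain ⟨gA, hgA, heA⟩ := hasLogOn_div_of_joinedIn hjoin'
  obtain ⟨gX, hgX, heX⟩ := hasLogOn_div_of_joinedIn hjoin
  -- Logarithms of `(z - a) / (z - b)` exist off the arc and off `X`. Their difference is constant
  -- along paths avoiding both sets; as nothing is assumed to be split, it depends only on the
  -- component of `Xᶜ`.
  have hd : ∀ p ∉ X ∪ range γ, ∀ q ∉ X ∪ range γ, JoinedIn Xᶜ p q →
      gA p - gX p = gA q - gX q := by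
    intro p hp q hq hpq
    have hj := hcon p hp q hq hpq
    obtain ⟨δ, hδ⟩ := hj
    refine (isPreconnected_range δ.continuous).eq_of_exp_eq_one
      (d := fun z => gA z - gX z) ?_ ?_ ⟨0, δ.source⟩ ⟨1, δ.target⟩
    · refine (hgA.mono ?_).sub (hgX.mono ?_)
      · rintro _ ⟨t, rfl⟩ h
        exact hδ t (Or.inr h)
      · rintro _ ⟨t, rfl⟩ h
        exact hδ t (Or.inl h)
    · rintro _ ⟨t, rfl⟩
      have h1 : δ t ∉ range γ := fun h => hδ t (Or.inr h)
      have h2 : δ t ∉ X := fun h => hδ t (Or.inl h)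
      rw [Complex.exp_sub, heA _ h1, heX _ h2, div_self]
      refine div_ne_zero (sub_ne_zero.2 ?_) (sub_ne_zero.2 ?_) <;> intro h
      · exact h1 ⟨0, h.symm⟩
      · exact h1 ⟨1, h.symm⟩
  -- Empty interior provides a point off the arc in each component of `Xᶜ`, through which the
  -- difference extends to a locally constant `c` on all of `Xᶜ`.
  have hw : ∀ z ∈ Xᶜ, ∃ w ∉ X ∪ range γ, JoinedIn Xᶜ z w := by
    intro z hz
    by_contra! h
    have hsub : pathComponentIn Xᶜ z ⊆ X ∪ range γ := fun w hw => by
      by_contra hwY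
      exact h w hwY hw
    have := interior_maximal hsub (hX.isClosed.isOpen_compl.pathComponentIn z)
    rw [hint] at this
    exact this (mem_pathComponentIn_self hz)
  choose! w hwY hwj using hw
  let c : ℂ → ℂ := fun z => gA (w z) - gX (w z)
  have hc : ∀ z ∈ Xᶜ, ∀ z', JoinedIn Xᶜ z z' → c z = c z' := fun z hz z' h =>
    hd _ (hwY z hz) _ (hwY z' h.target_mem) (((hwj z hz).symm.trans h).trans (hwj z' h.target_mem))
  have hcc : ContinuousOn c Xᶜ := by
    intro z hz
    refine ContinuousAt.continuousWithinAt (ContinuousAt.congr (continuousAt_const (y := c z)) ?_)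
    filter_upwards [(hX.isClosed.isOpen_compl.pathComponentIn z).mem_nhds
      (mem_pathComponentIn_self hz)] with z' hz'
    exact hc z hz z' hz'
  have hce : ∀ z ∉ X ∪ range γ, c z = gA z - gX z := fun z hz => by
    have hzX : z ∈ Xᶜ := fun h => hz (Or.inl h)
    exact hd _ (hwY z hzX) _ hz (hwj z hzX).symm
  have hcexp : ∀ z ∈ Xᶜ, Complex.exp (c z) = 1 := by
    intro z hz
    have h1 : w z ∉ range γ := fun h => hwY z hz (Or.inr h)
    have h2 : w z ∉ X := fun h => hwY z hz (Or.inl h)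
    simp only [c]
    rw [Complex.exp_sub, heA _ h1, heX _ h2, div_self]
    refine div_ne_zero (sub_ne_zero.2 ?_) (sub_ne_zero.2 ?_) <;> intro h
    · exact h1 ⟨0, h.symm⟩
    · exact h1 ⟨1, h.symm⟩
  -- `gA` and the corrected `gX + c` agree on the overlap, giving a logarithm off `X ∩ range γ`,
  -- hence everywhere except possibly at `a` and `b`.
  have hlog : HasLogOn (fun z => (z - a) / (z - b)) ((range γ)ᶜ ∪ Xᶜ) := by
    have hl : EqOn ((range γ)ᶜ.piecewise gA fun z => gX z + c z) gA (range γ)ᶜ :=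
      piecewise_eqOn _ _ _
    have hr : EqOn ((range γ)ᶜ.piecewise gA fun z => gX z + c z) (fun z => gX z + c z) Xᶜ := by
      intro z hz
      by_cases h : z ∈ (range γ)ᶜ
      · simp only [piecewise_eq_of_mem _ _ _ h, hce z fun h' => h'.elim hz h, add_sub_cancel]
      · rw [piecewise_eq_of_notMem _ _ _ h]
    refine ⟨_, (hgA.congr hl).union_of_isOpen ((hgX.add hcc).congr hr) hA.isClosed.isOpen_compl
      hX.isClosed.isOpen_compl, ?_⟩
    rintro z (hz | hz)
    · rw [hl hz, heA z hz]
    · rw [hr hz, Complex.exp_add, hcexp z hz, heX z hz, mul_one]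
  have hab : 0 < ‖b - a‖ := norm_pos_iff.2 (sub_ne_zero.2 hne.symm)
  -- This circle surrounds `a` but not `b`, so the degree inside is 1, contradicting the logarithm.
  have hsub : Metric.sphere a (‖b - a‖ / 2) ⊆ (range γ)ᶜ ∪ Xᶜ := by
    intro z hz
    by_contra h
    rw [mem_union, not_or, notMem_compl_iff, notMem_compl_iff] at h
    rw [mem_sphere_iff_norm] at hz
    rcases hXY h.symm with rfl | h
    · simp only [sub_self, norm_zero] at hz
      linarith
    · rw [mem_singleton_iff] at h
      rw [h] at hz
      linarith
  have := sum_eq_zero_of_hasLogOn (U := Metric.ball a (‖b - a‖ / 2)) Metric.isOpen_ball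
    Metric.isBounded_ball Metric.isClosed_sphere Metric.frontier_ball_subset_sphere ![a, b] ![1, -1]
    (by
      simp only [Fin.forall_fin_two, Matrix.cons_val_zero, Matrix.cons_val_one, mem_sphere_iff_norm,
        sub_self, norm_zero]
      constructor <;> intro h <;> linarith)
    ((hlog.mono hsub).congr fun z _ => by simp [Fin.prod_univ_two, div_eq_mul_inv])
  rw [Finset.sum_filter, Fin.sum_univ_two] at this
  simp [Metric.mem_ball, dist_eq_norm, hab] at this
  rw [if_neg (by linarith)] at this
  simp at this

/-! ### Counting regions -/

/-- The number of connected components of the complement of a set. -/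
noncomputable def regionCount {M : Type*} [TopologicalSpace M] (X : Set M) : ℕ∞ :=
  ENat.card (ConnectedComponents ↥Xᶜ)

section Count

/-- Only the pair `a, b` is identified by `f`, so deleting `a` leaves a bijection. -/
theorem ENat.card_eq_add_one_of_surjective {α β : Type*} {f : α → β} (hf : Function.Surjective f)
    {a b : α} (hab : a ≠ b) (hfab : f a = f b)
    (h : ∀ x y, f x = f y → x ≠ y → (x = a ∧ y = b) ∨ (x = b ∧ y = a)) :
    ENat.card α = ENat.card β + 1 := by
  classical
  let g : {x // x ≠ a} → β := fun x => f x
  have hg : Function.Bijective g := by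
    constructor
    · rintro ⟨x, hx⟩ ⟨y, hy⟩ hxy
      by_contra hne
      rcases h x y hxy fun h => hne (Subtype.ext h) with h | h
      exacts [hx h.1, hy h.2]
    · intro z
      obtain ⟨x, rfl⟩ := hf z
      by_cases hx : x = a
      · exact ⟨⟨b, hab.symm⟩, by rw [hx, hfab]⟩
      · exact ⟨⟨x, hx⟩, rfl⟩
  rw [← ENat.card_congr (Equiv.ofBijective g hg), ENat.card_congr (Equiv.optionSubtypeNe a).symm,
    ENat.card_congr (Equiv.optionEquivSumPUnit.{0} _), ENat.card_sum]
  simp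

variable {X Y : Set ℂ}

theorem ConnectedComponents.coe_eq_coe_iff_joinedIn {U : Set ℂ} (hU : IsOpen U) {p q : ↥U} :
    (p : ConnectedComponents ↥U) = q ↔ JoinedIn U p q := by
  have := hU.locallyPathConnectedSpace
  rw [ConnectedComponents.coe_eq_coe', ← pathComponent_eq_connectedComponent,
    mem_pathComponent_iff, joinedIn_iff_joined p.2 q.2]
  exact ⟨fun h => h.symm, fun h => h.symm⟩

/-- The component of `Xᶜ` containing a given component of `Yᶜ`. -/
noncomputable def regionMap {X Y : Set ℂ} (hXY : X ⊆ Y) : ConnectedComponents ↥Yᶜ → ConnectedComponents ↥Xᶜ :=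
  (continuous_inclusion (compl_subset_compl.2 hXY)).connectedComponentsMap

theorem regionMap_coe (hXY : X ⊆ Y) (p : ↥Yᶜ) :
    regionMap hXY p = (inclusion (compl_subset_compl.2 hXY) p : ConnectedComponents ↥Xᶜ) := rfl

/-- A component of `Xᶜ` is open and nonempty, so a set with empty interior cannot swallow it. -/
theorem regionMap_surjective (hX : IsClosed X) (hXY : X ⊆ Y) (hint : interior Y = ∅) :
    Function.Surjective (regionMap hXY) := by
  intro c
  obtain ⟨z, rfl⟩ := ConnectedComponents.surjective_coe c
  have : ¬ pathComponentIn Xᶜ (z : ℂ) ⊆ Y := fun hsub => by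
    have := interior_maximal hsub (hX.isOpen_compl.pathComponentIn (z : ℂ))
    rw [hint] at this
    exact this (mem_pathComponentIn_self z.2)
  obtain ⟨w, hw, hwY⟩ := not_subset.1 this
  refine ⟨((⟨w, hwY⟩ : ↥Yᶜ) : ConnectedComponents ↥Yᶜ), ?_⟩
  rw [regionMap_coe, ConnectedComponents.coe_eq_coe_iff_joinedIn hX.isOpen_compl]
  exact JoinedIn.symm hw

theorem regionCount_eq_of_joinedIn (hX : IsClosed X) (hY : IsClosed Y) (hXY : X ⊆ Y)
    (hint : interior Y = ∅)
    (h : ∀ p ∉ Y, ∀ q ∉ Y, JoinedIn Xᶜ p q → JoinedIn Yᶜ p q) :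
    regionCount Y = regionCount X := by
  refine ENat.card_congr (Equiv.ofBijective (regionMap hXY) ⟨?_, regionMap_surjective hX hXY hint⟩)
  intro a b hab
  obtain ⟨p, rfl⟩ := ConnectedComponents.surjective_coe a
  obtain ⟨q, rfl⟩ := ConnectedComponents.surjective_coe b
  rw [regionMap_coe, regionMap_coe,
    ConnectedComponents.coe_eq_coe_iff_joinedIn hX.isOpen_compl] at hab
  rw [ConnectedComponents.coe_eq_coe_iff_joinedIn hY.isOpen_compl]
  exact h p p.2 q q.2 hab

theorem regionCount_eq_add_one_of_joinedIn (hX : IsClosed X) (hY : IsClosed Y) (hXY : X ⊆ Y)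
    (hint : interior Y = ∅)
    (hex : ∃ p ∉ Y, ∃ q ∉ Y, JoinedIn Xᶜ p q ∧ ¬ JoinedIn Yᶜ p q)
    (h : ∀ p ∉ Y, ∀ q ∉ Y, ∀ p' ∉ Y, ∀ q' ∉ Y, JoinedIn Xᶜ p q → JoinedIn Xᶜ p' q' →
      ¬ JoinedIn Yᶜ p q → ¬ JoinedIn Yᶜ p' q' →
      (JoinedIn Yᶜ p p' ∨ JoinedIn Yᶜ p q') ∧ (JoinedIn Yᶜ q p' ∨ JoinedIn Yᶜ q q')) :
    regionCount Y = regionCount X + 1 := by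
  obtain ⟨p', hp', q', hq', hX', hY'⟩ := hex
  refine ENat.card_eq_add_one_of_surjective (regionMap_surjective hX hXY hint)
    (a := ((⟨p', hp'⟩ : ↥Yᶜ) : ConnectedComponents ↥Yᶜ)) (b := (⟨q', hq'⟩ : ↥Yᶜ)) ?_ ?_ ?_
  · rwa [ne_eq, ConnectedComponents.coe_eq_coe_iff_joinedIn hY.isOpen_compl]
  · rwa [regionMap_coe, regionMap_coe, ConnectedComponents.coe_eq_coe_iff_joinedIn hX.isOpen_compl]
  · intro a b
    obtain ⟨p, rfl⟩ := ConnectedComponents.surjective_coe a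
    obtain ⟨q, rfl⟩ := ConnectedComponents.surjective_coe b
    rw [regionMap_coe, regionMap_coe, ne_eq,
      ConnectedComponents.coe_eq_coe_iff_joinedIn hX.isOpen_compl]
    simp only [ConnectedComponents.coe_eq_coe_iff_joinedIn hY.isOpen_compl]
    intro hab hne
    obtain ⟨h1, h2⟩ := h p p.2 q q.2 p' hp' q' hq' hab hX' hne hY'
    rcases h1 with h1 | h1 <;> rcases h2 with h2 | h2
    · exact absurd (h1.trans h2.symm) hne
    · exact Or.inl ⟨h1, h2⟩
    · exact Or.inr ⟨h1, h2⟩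
    · exact absurd (h1.trans h2.symm) hne

/-- An isolated point is no obstruction to a logarithm: any logarithm of the value at `m` will do
there. -/
theorem regionCount_insert {X : Set ℂ} (hX : IsCompact X) (hint : interior X = ∅) {m : ℂ}
    (hm : m ∉ X) : regionCount (insert m X) = regionCount X := by
  classical
  have hY : IsCompact (insert m X) := hX.insert m
  refine regionCount_eq_of_joinedIn hX.isClosed hY.isClosed (subset_insert m X) ?_ ?_
  · rw [insert_eq, union_comm, interior_union_isClosed_of_interior_empty hX.isClosed
      (interior_singleton m), hint]
  · intro p hp q hq hpq
    refine .of_hasLogOn hY hp hq ?_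
    obtain ⟨g, hg, he⟩ := hasLogOn_div_of_joinedIn hpq
    rw [compl_compl] at hg he
    have hne : (m - p) / (m - q) ≠ 0 := by
      refine div_ne_zero (sub_ne_zero.2 ?_) (sub_ne_zero.2 ?_) <;> rintro rfl
      · exact hp (mem_insert _ _)
      · exact hq (mem_insert _ _)
    have hgX : EqOn (Function.update g m (Complex.log ((m - p) / (m - q)))) g X := by
      intro z hz
      rw [Function.update_of_ne]
      rintro rfl
      exact hm hz
    refine ⟨Function.update g m (Complex.log ((m - p) / (m - q))), ?_, ?_⟩
    · rw [insert_eq]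
      exact (continuousOn_singleton _ _).union_of_isClosed (hg.congr hgX) isClosed_singleton
        hX.isClosed
    · rintro z (rfl | hz)
      · rw [Function.update_self, Complex.exp_log hne]
      · rw [hgX hz, he z hz]

end Count

/-! ### Arcs have empty interior -/

section Interior

/-- The midpoint of `k 0` and `k 1` is attained at some `z`; the plane without `z` is still
connected and contains 0 and 1, so it is attained again. -/
theorem not_injective_of_continuous_complex {k : ℂ → ℝ} (hk : Continuous k) :
    ¬ Function.Injective k := by
  intro hinj
  have hm : (k 0 + k 1) / 2 ∈ uIcc (k 0) (k 1) := by
    rw [mem_uIcc]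
    rcases le_total (k 0) (k 1) with h | h
    · exact Or.inl ⟨by linarith, by linarith⟩
    · exact Or.inr ⟨by linarith, by linarith⟩
  have h01 : k 0 ≠ k 1 := fun h => zero_ne_one (hinj h)
  obtain ⟨z, -, hz⟩ := (isPreconnected_univ.image k hk.continuousOn).ordConnected.uIcc_subset
    (mem_image_of_mem k (mem_univ 0)) (mem_image_of_mem k (mem_univ 1)) hm
  have h0 : (0 : ℂ) ∈ ({z}ᶜ : Set ℂ) := by
    rintro rfl
    exact h01 (by linarith)
  have h1 : (1 : ℂ) ∈ ({z}ᶜ : Set ℂ) := by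
    rintro rfl
    exact h01 (by linarith)
  obtain ⟨w, hw, hw'⟩ := ((isConnected_compl_singleton_of_one_lt_rank (by simp)
    z).isPreconnected.image k hk.continuousOn).ordConnected.uIcc_subset
    (mem_image_of_mem k h0) (mem_image_of_mem k h1) hm
  exact hw (hinj (hw'.trans hz.symm))

/-- Otherwise a copy of the plane would lie in the arc, and reading off its parameter would inject
the plane continuously into the interval. The ends are removed first, because `γ` is injective only
on the open interval. -/
theorem interior_range_arc_eq_empty {M : Type*} [TopologicalSpace M] [T2Space M]
    (hM : ∀ O : Set M, IsOpen O → O.Nonempty →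
      ∃ h : ℂ → M, Continuous h ∧ Function.Injective h ∧ range h ⊆ O)
    {γ : C(I, M)} (hγ : InjOn γ (Ioo 0 1)) : interior (range γ) = ∅ := by
  by_contra hne
  have hends : (({γ 0, γ 1} : Set M)).Finite := (finite_singleton _).insert _
  have hO : (interior (range γ) \ {γ 0, γ 1}).Nonempty := by
    obtain ⟨h, -, hinj, hr⟩ := hM _ isOpen_interior (nonempty_iff_ne_empty.2 hne)
    exact ((infinite_range_of_injective hinj).mono hr).sdiff hends |>.nonempty
  obtain ⟨h, hc, hinj, hr⟩ := hM _ (isOpen_interior.sdiff hends.isClosed) hO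
  have hr0 : ∀ z, h z ≠ γ 0 := fun z hz => (hr ⟨z, rfl⟩).2 (Or.inl hz)
  have hr1 : ∀ z, h z ≠ γ 1 := fun z hz => (hr ⟨z, rfl⟩).2 (Or.inr hz)
  have hI : ∀ z t, γ t = h z → t ∈ Ioo (0 : I) 1 := by
    intro z t hzt
    constructor
    · refine unitInterval.pos_iff_ne_zero.2 ?_
      rintro rfl
      exact hr0 z hzt.symm
    · refine unitInterval.lt_one_iff_ne_one.2 ?_
      rintro rfl
      exact hr1 z hzt.symm
  choose k hk using fun z => interior_subset (hr ⟨z, rfl⟩).1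
  have hkc : Continuous k := by
    -- The inverse parametrization is continuous because `γ` sends closed sets, being compact, to
    -- closed sets.
    refine continuous_iff_isClosed.2 fun F hF => ?_
    have : k ⁻¹' F = h ⁻¹' (γ '' F) := by
      ext z
      refine ⟨fun hz => ⟨k z, hz, hk z⟩, ?_⟩
      rintro ⟨t, ht, htz⟩
      rw [mem_preimage, hγ (hI z _ (hk z)) (hI z t htz) ((hk z).trans htz.symm)]
      exact ht
    rw [this]
    exact ((hF.isCompact.image γ.continuous).isClosed).preimage hc
  refine not_injective_of_continuous_complex (k := fun z => ((k z : I) : ℝ)) (by fun_prop) ?_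
  intro z w hzw
  apply hinj
  rw [← hk z, ← hk w, Subtype.ext hzw]

theorem exists_continuous_injective_range_subset {O : Set ℂ} (hO : IsOpen O) (hne : O.Nonempty) :
    ∃ h : ℂ → ℂ, Continuous h ∧ Function.Injective h ∧ range h ⊆ O := by
  obtain ⟨c, hc⟩ := hne
  obtain ⟨r, hr, hb⟩ := Metric.isOpen_iff.1 hO c hc
  let u := OpenPartialHomeomorph.univBall c r
  have hs : u.source = univ := OpenPartialHomeomorph.univBall_source c r
  refine ⟨u, OpenPartialHomeomorph.continuous_univBall c r, ?_, ?_⟩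
  · intro z w hzw
    exact u.injOn (hs ▸ mem_univ z) (hs ▸ mem_univ w) hzw
  · rintro _ ⟨z, rfl⟩
    refine hb ?_
    rw [← OpenPartialHomeomorph.univBall_target c hr]
    exact u.map_source (hs ▸ mem_univ z)

end Interior

/-! ### Euler's formula in the plane -/

/-- The Euler relation `regions + vertices = 1 + pieces + edges` for a plane set `X`, the pieces
being the members of a finite partition of `X` into closed path-connected sets. -/
def EulerRelation (X : Set ℂ) (v e : ℕ) (P : Finset (Set ℂ)) : Prop :=
  IsCompact X ∧ interior X = ∅ ∧ (∀ s ∈ P, IsClosed s ∧ IsPathConnected s) ∧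
    (P : Set (Set ℂ)).PairwiseDisjoint id ∧ ⋃₀ (P : Set (Set ℂ)) = X ∧
    regionCount X + v = 1 + P.card + e

theorem regionCount_empty : regionCount (∅ : Set ℂ) = 1 := by
  rw [regionCount, compl_empty]
  have : PreconnectedSpace ↥(univ : Set ℂ) := Subtype.preconnectedSpace isPreconnected_univ
  have : Inhabited (ConnectedComponents ↥(univ : Set ℂ)) := ⟨((⟨0, mem_univ 0⟩ : ↥(univ : Set ℂ)))⟩
  have : Subsingleton (ConnectedComponents ↥(univ : Set ℂ)) := by
    refine ⟨fun a b => ?_⟩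
    obtain ⟨p, rfl⟩ := ConnectedComponents.surjective_coe a
    obtain ⟨q, rfl⟩ := ConnectedComponents.surjective_coe b
    rw [ConnectedComponents.coe_eq_coe', PreconnectedSpace.connectedComponent_eq_univ]
    trivial
  exact ENat.card_eq_one_iff_unique.2 ⟨Unique.mk' _⟩

namespace EulerRelation

variable {X : Set ℂ} {v e : ℕ} {P : Finset (Set ℂ)}

theorem empty : EulerRelation ∅ 0 0 ∅ := by
  refine ⟨isCompact_empty, interior_empty, by simp, by simp, by simp, ?_⟩
  simp [regionCount_empty]

theorem insert_point (h : EulerRelation X v e P) {m : ℂ} (hm : m ∉ X) :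
    ∃ P', EulerRelation (insert m X) (v + 1) e P' := by
  classical
  obtain ⟨hX, hint, hP, hd, hU, hc⟩ := h
  have hmP : ∀ s ∈ P, m ∉ s := fun s hs hms => hm (hU ▸ mem_sUnion_of_mem hms hs)
  have hmP' : {m} ∉ P := fun h => hmP _ h rfl
  refine ⟨insert {m} P, hX.insert m, ?_, ?_, ?_, ?_, ?_⟩
  · rw [insert_eq, union_comm, interior_union_isClosed_of_interior_empty hX.isClosed
      (interior_singleton m), hint]
  · rw [Finset.forall_mem_insert]
    exact ⟨⟨isClosed_singleton, isPathConnected_singleton m⟩, hP⟩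
  · rw [Finset.coe_insert]
    refine hd.insert fun s hs _ => ?_
    simpa using hmP s hs
  · rw [Finset.coe_insert, sUnion_insert, hU, insert_eq]
  · rw [regionCount_insert hX hint hm, Finset.card_insert_of_notMem hmP']
    push_cast
    rw [← add_assoc, hc]
    ring

/-- If both ends lie in one piece, a region is gained and the number of pieces is unchanged; if they
lie in two pieces, these merge and no region is gained. Both cases balance the extra edge. -/
theorem union_arc (h : EulerRelation X v e P) {γ : C(I, ℂ)} (hγ : Function.Injective γ)
    (hγX : ∀ t ∈ Ioo (0 : I) 1, γ t ∉ X) (h0 : γ 0 ∈ X) (h1 : γ 1 ∈ X) :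
    ∃ P', EulerRelation (X ∪ range γ) v (e + 1) P' := by
  classical
  obtain ⟨hX, hint, hP, hd, hU, hc⟩ := h
  have hA : IsCompact (range γ) := isCompact_range γ.continuous
  have : PathConnectedSpace I :=
    isPathConnected_iff_pathConnectedSpace.1 ((convex_Icc (0 : ℝ) 1).isPathConnected ⟨0, by simp⟩)
  have hApc : IsPathConnected (range γ) := isPathConnected_range γ.continuous
  have hYint : interior (X ∪ range γ) = ∅ := by
    rw [interior_union_isClosed_of_interior_empty hX.isClosed (interior_range_arc_eq_empty
      (fun O hO hne => exists_continuous_injective_range_subset hO hne) hγ.injOn), hint]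
  have hXY : X ∩ range γ ⊆ {γ 0, γ 1} := by
    rintro _ ⟨hz, t, rfl⟩
    by_contra hcon
    rw [mem_insert_iff, mem_singleton_iff, not_or] at hcon
    refine hγX t ⟨unitInterval.pos_iff_ne_zero.2 ?_, unitInterval.lt_one_iff_ne_one.2 ?_⟩ hz
    · rintro rfl
      exact hcon.1 rfl
    · rintro rfl
      exact hcon.2 rfl
  have hdisj : ∀ s ∈ P, γ 0 ∉ s → γ 1 ∉ s → Disjoint s (range γ) := by
    intro s hs hs0 hs1
    rw [Set.disjoint_left]
    intro z hz hzA
    rcases hXY ⟨hU ▸ mem_sUnion_of_mem hz hs, hzA⟩ with rfl | h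
    · exact hs0 hz
    · rw [mem_singleton_iff] at h
      exact hs1 (h ▸ hz)
  obtain ⟨s, hs, hs0⟩ := mem_sUnion.1 (hU.symm ▸ h0 : γ 0 ∈ ⋃₀ (P : Set (Set ℂ)))
  obtain ⟨t, ht, ht1⟩ := mem_sUnion.1 (hU.symm ▸ h1 : γ 1 ∈ ⋃₀ (P : Set (Set ℂ)))
  have huniq : ∀ {a b : Set ℂ} {z : ℂ}, a ∈ P → b ∈ P → z ∈ a → z ∈ b → a = b :=
    fun ha hb hza hzb => hd.elim ha hb (Set.not_disjoint_iff.2 ⟨_, hza, hzb⟩)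
  have hPs : P = insert s (P.erase s) := (Finset.insert_erase hs).symm
  have hUs : s ∪ ⋃₀ (P.erase s : Set (Set ℂ)) = X := by
    rw [← sUnion_insert, ← Finset.coe_insert, ← hPs, hU]
  have hdisjs : ∀ a ∈ P, a ≠ s → Disjoint s a := fun a ha hne => hd hs ha hne.symm
  by_cases hst : s = t
  · subst hst
    have hnew : s ∪ range γ ∉ P.erase s := by
      intro h
      rw [Finset.mem_erase] at h
      exact h.1 (huniq h.2 hs (Or.inl hs0) hs0)
    refine ⟨insert (s ∪ range γ) (P.erase s), hX.union hA, hYint, ?_, ?_, ?_, ?_⟩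
    · rw [Finset.forall_mem_insert]
      refine ⟨⟨(hP s hs).1.union hA.isClosed, (hP s hs).2.union hApc ⟨γ 0, hs0, 0, rfl⟩⟩, ?_⟩
      intro a ha
      exact hP a (Finset.mem_of_mem_erase ha)
    · rw [Finset.coe_insert]
      refine (hd.subset (Finset.coe_subset.2 (Finset.erase_subset _ _))).insert fun a ha _ => ?_
      rw [Finset.mem_coe, Finset.mem_erase] at ha
      have hsa := hdisjs a ha.2 ha.1
      exact hsa.union_left (hdisj a ha.2 (Set.disjoint_left.1 hsa hs0)
        (Set.disjoint_left.1 hsa ht1)).symm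
    · rw [Finset.coe_insert, sUnion_insert, union_right_comm, hUs]
    · have hcount : regionCount (X ∪ range γ) = regionCount X + 1 :=
        regionCount_eq_add_one_of_joinedIn hX.isClosed (hX.union hA).isClosed subset_union_left hYint
          (exists_not_joinedIn_compl_union_range hX hXY (fun h => zero_ne_one (hγ h))
            (((hP s hs).2.joinedIn _ hs0 _ ht1).mono (hU ▸ subset_sUnion_of_mem hs)) hYint)
          fun p hp q hq p' hp' q' hq' => joinedIn_or_of_not_joinedIn hX hγ hγX h0 h1 hp hq hp' hq'
      rw [hcount, Finset.card_insert_of_notMem hnew, Finset.card_erase_add_one hs, add_right_comm, hc]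
      push_cast
      ring
  · have hts : t ∈ P.erase s := Finset.mem_erase.2 ⟨Ne.symm hst, ht⟩
    have hPt : P.erase s = insert t ((P.erase s).erase t) := (Finset.insert_erase hts).symm
    have hUt : t ∪ ⋃₀ ((P.erase s).erase t : Set (Set ℂ)) = ⋃₀ (P.erase s : Set (Set ℂ)) := by
      rw [← sUnion_insert, ← Finset.coe_insert, ← hPt]
    have hnew : s ∪ t ∪ range γ ∉ (P.erase s).erase t := by
      intro h
      rw [Finset.mem_erase, Finset.mem_erase] at h
      exact h.2.1 (huniq h.2.2 hs (Or.inl (Or.inl hs0)) hs0)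
    refine ⟨insert (s ∪ t ∪ range γ) ((P.erase s).erase t), hX.union hA, hYint, ?_, ?_, ?_, ?_⟩
    · rw [Finset.forall_mem_insert]
      refine ⟨⟨((hP s hs).1.union (hP t ht).1).union hA.isClosed, ?_⟩, ?_⟩
      · rw [union_right_comm]
        exact ((hP s hs).2.union hApc ⟨γ 0, hs0, 0, rfl⟩).union (hP t ht).2
          ⟨γ 1, Or.inr ⟨1, rfl⟩, ht1⟩
      · intro a ha
        exact hP a (Finset.mem_of_mem_erase (Finset.mem_of_mem_erase ha))
    · rw [Finset.coe_insert]
      refine (hd.subset (Finset.coe_subset.2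
        ((Finset.erase_subset _ _).trans (Finset.erase_subset _ _)))).insert fun a ha _ => ?_
      rw [Finset.mem_coe, Finset.mem_erase, Finset.mem_erase] at ha
      have hsa := hdisjs a ha.2.2 ha.2.1
      have hta : Disjoint t a := hd ht ha.2.2 ha.1.symm
      exact (hsa.union_left hta).union_left (hdisj a ha.2.2 (Set.disjoint_left.1 hsa hs0)
        (Set.disjoint_left.1 hta ht1)).symm
    · rw [Finset.coe_insert, sUnion_insert, union_right_comm, union_assoc s t, hUt, hUs]
    -- The arc runs from `s` to the union of all other pieces, two disjoint closed sets, so it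
    -- separates nothing.
    · have hT : IsClosed (⋃₀ (P.erase s : Set (Set ℂ))) :=
by
        rw [sUnion_eq_biUnion]
        exact (P.erase s).finite_toSet.isClosed_biUnion fun a ha =>
          (hP a (Finset.mem_of_mem_erase ha)).1
      have hsT : Disjoint s (⋃₀ (P.erase s : Set (Set ℂ))) := by
        rw [disjoint_sUnion_right]
        intro a ha
        rw [Finset.mem_coe, Finset.mem_erase] at ha
        exact hdisjs a ha.2 ha.1
      have hcount : regionCount (X ∪ range γ) = regionCount X :=
        regionCount_eq_of_joinedIn hX.isClosed (hX.union hA).isClosed subset_union_left hYint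
          fun p hp q hq => joinedIn_compl_union_range_of_separated hX hγ hγX (hP s hs).1 hT hsT
            hUs.symm hs0 (mem_sUnion_of_mem ht1 hts) hp hq
      rw [hcount, hc, Finset.card_insert_of_notMem hnew, Finset.card_erase_add_one hts,
        ← Finset.card_erase_add_one hs]
      push_cast
      ring

/-- Adding an edge, possibly a loop. -/
theorem union_edge (h : EulerRelation X v e P) {γ : C(I, ℂ)} (hγ : InjOn γ (Ioo 0 1))
    (hγX : ∀ t ∈ Ioo (0 : I) 1, γ t ∉ X) (h0 : γ 0 ∈ X) (h1 : γ 1 ∈ X) :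
    ∃ P', EulerRelation (X ∪ range γ) v (e + 1) P' := by
  -- A loop is not injective, but its two halves are. The midpoint is added as a vertex and then the
  -- halves as arcs.
  let l : C(I, I) := ⟨fun t => ⟨t / 2, by constructor <;> linarith [t.2.1, t.2.2]⟩, by fun_prop⟩
  let r : C(I, I) := ⟨fun t => ⟨(1 + t) / 2, by constructor <;> linarith [t.2.1, t.2.2]⟩, by fun_prop⟩
  have hl0 : l 0 = 0 := by ext; simp [l]
  have hr1 : r 1 = 1 := by ext; norm_num [r]
  have hlr : l 1 = r 0 := by ext; norm_num [l, r]
  have hlI : ∀ t : I, t ≠ 0 → l t ∈ Ioo (0 : I) 1 := by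
    intro t ht
    have h2 : (0 : ℝ) < t := unitInterval.pos_iff_ne_zero.2 ht
    have h3 := t.2.2
    constructor
    · change (0 : ℝ) < t / 2
      linarith
    · change (t / 2 : ℝ) < 1
      linarith
  have hrI : ∀ t : I, t ≠ 1 → r t ∈ Ioo (0 : I) 1 := by
    intro t ht
    have h2 : (t : ℝ) < 1 := unitInterval.lt_one_iff_ne_one.2 ht
    have h3 := t.2.1
    constructor
    · change (0 : ℝ) < (1 + t) / 2
      linarith
    · change ((1 + t) / 2 : ℝ) < 1
      linarith
  have hlinj : Function.Injective l := fun s t hst => by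
    have : (s / 2 : ℝ) = t / 2 := congrArg Subtype.val hst
    exact Subtype.ext (by linarith)
  have hrinj : Function.Injective r := fun s t hst => by
    have : ((1 + s) / 2 : ℝ) = (1 + t) / 2 := congrArg Subtype.val hst
    exact Subtype.ext (by linarith)
  have hlrne : ∀ s t : I, l s = r t → t = 0 := fun s t hst => by
    have : (s / 2 : ℝ) = (1 + t) / 2 := congrArg Subtype.val hst
    have h3 := s.2.2
    have h4 := t.2.1
    exact Subtype.ext (le_antisymm (by change (t : ℝ) ≤ 0; linarith) h4)
  have hγne : ∀ s t : I, s ∈ Ioo (0 : I) 1 → γ s = γ t → s = t := by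
    intro s t hs hst
    by_cases ht : t ∈ Ioo (0 : I) 1
    · exact hγ hs ht hst
    · exfalso
      refine hγX s hs (hst ▸ ?_)
      rcases eq_or_ne t 0 with rfl | ht0
      · exact h0
      rcases eq_or_ne t 1 with rfl | ht1
      · exact h1
      · exact absurd ⟨unitInterval.pos_iff_ne_zero.2 ht0, unitInterval.lt_one_iff_ne_one.2 ht1⟩ ht
  have hlγ : Function.Injective (γ.comp l) := by
    intro s t hst
    by_cases hs : s = 0
    · by_cases ht : t = 0
      · rw [hs, ht]
      · exact (hlinj (hγne _ _ (hlI t ht) hst.symm)).symm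
    · exact hlinj (hγne _ _ (hlI s hs) hst)
  have hrγ : Function.Injective (γ.comp r) := by
    intro s t hst
    by_cases hs : s = 1
    · by_cases ht : t = 1
      · rw [hs, ht]
      · exact (hrinj (hγne _ _ (hrI t ht) hst.symm)).symm
    · exact hrinj (hγne _ _ (hrI s hs) hst)
  have hm := hlI 1 one_ne_zero
  obtain ⟨P₁, H₁⟩ := h.insert_point (hγX _ hm)
  obtain ⟨P₂, H₂⟩ := H₁.union_arc hlγ (fun t ht => by
    rintro (h | h)
    · exact ht.2.ne (hlinj (hγne _ _ (hlI t ht.1.ne') h))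
    · exact hγX _ (hlI t ht.1.ne') h) (by simp [hl0, h0]) (by simp)
  obtain ⟨P₃, H₃⟩ := H₂.union_arc hrγ (fun t ht => by
    rintro ((h | h) | ⟨s, h⟩)
    · exact ht.1.ne' (hlrne _ _ (hγne _ _ (hrI t ht.2.ne) h).symm)
    · exact hγX _ (hrI t ht.2.ne) h
    · exact ht.1.ne' (hlrne s t (hγne _ _ (hrI t ht.2.ne) h.symm).symm)) (by simp [hlr])
    (by simp [hr1, h1])
  have hY : insert (γ (l 1)) X ∪ range (γ.comp l) ∪ range (γ.comp r) = X ∪ range γ := by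
    refine Subset.antisymm ?_ ?_
    · rintro z (((rfl | h) | ⟨t, rfl⟩) | ⟨t, rfl⟩)
      · exact Or.inr ⟨_, rfl⟩
      · exact Or.inl h
      · exact Or.inr ⟨_, rfl⟩
      · exact Or.inr ⟨_, rfl⟩
    · rintro z (h | ⟨t, rfl⟩)
      · exact Or.inl (Or.inl (Or.inr h))
      · rcases le_total (t : ℝ) (1 / 2) with ht | ht
        · refine Or.inl (Or.inr ⟨⟨2 * t, by constructor <;> linarith [t.2.1]⟩, ?_⟩)
          rw [ContinuousMap.comp_apply]
          congr 1
          ext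
          simp [l]
        · refine Or.inr ⟨⟨2 * t - 1, by constructor <;> linarith [t.2.2]⟩, ?_⟩
          rw [ContinuousMap.comp_apply]
          congr 1
          ext
          simp [r]
  rw [hY] at H₃
  obtain ⟨hX, hint, hP, hd, hU, hc⟩ := H₃
  refine ⟨P₃, hX, hint, hP, hd, hU, ?_⟩
  -- The subdivision counted one extra vertex and one extra edge; they cancel.
  refine ENat.add_left_injective_of_ne_top ENat.one_ne_top ?_
  push_cast at hc ⊢
  rw [add_assoc, hc]
  ring

end EulerRelation

namespace Graph.TopEmbedding

variable {α β : Type*} {G : Graph α β}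

/-- Euler's formula for an embedded plane graph. -/
theorem exists_eulerRelation (φ : G.TopEmbedding ℂ) (hV : V(G).Finite) (hE : E(G).Finite) :
    ∃ P, EulerRelation φ.image V(G).ncard E(G).ncard P := by
  classical
  have h1 : ∀ s : Finset α, (s : Set α) ⊆ V(G) →
      ∃ P, EulerRelation (φ.point '' s) s.card 0 P := by
    intro s
    induction s using Finset.induction_on with
    | empty => exact fun _ => ⟨∅, by simpa using EulerRelation.empty⟩
    | insert x s hx ih =>
      intro hs
      rw [Finset.coe_insert, insert_subset_iff] at hs
      obtain ⟨P, hP⟩ := ih hs.2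
      rw [Finset.coe_insert, image_insert_eq, Finset.card_insert_of_notMem hx]
      refine hP.insert_point ?_
      rintro ⟨y, hy, hxy⟩
      exact hx (φ.point_injOn (hs.2 hy) hs.1 hxy ▸ hy)
  have h2 : ∀ F : Finset β, (F : Set β) ⊆ E(G) →
      ∃ P, EulerRelation (φ.point '' V(G) ∪ ⋃ e ∈ (F : Set β), range (φ.arc e)) V(G).ncard F.card P := by
    intro F
    induction F using Finset.induction_on with
    | empty =>
      intro _
      have := h1 hV.toFinset (by simp)
      rw [← ncard_eq_toFinset_card _ hV] at this
      simpa using this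
    | insert e F he ih =>
      intro hF
      rw [Finset.coe_insert, insert_subset_iff] at hF
      obtain ⟨P, hP⟩ := ih hF.2
      rw [Finset.coe_insert, biUnion_insert, union_comm (range _), ← union_assoc,
        Finset.card_insert_of_notMem he]
      obtain ⟨x, y, hxy, h0, h1⟩ := φ.arc_ends e hF.1
      refine hP.union_edge (φ.arc_injOn e hF.1) ?_ (Or.inl ⟨x, hxy.left_mem, h0.symm⟩)
        (Or.inl ⟨y, hxy.right_mem, h1.symm⟩)
      rintro t ht (⟨z, hz, hzt⟩ | h)
      · exact φ.arc_ne_point e hF.1 z hz t ht hzt.symm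
      · simp only [mem_iUnion] at h
        obtain ⟨f, hf, s, hs⟩ := h
        have hfE := hF.2 hf
        have hef : e ≠ f := by
          rintro rfl
          exact he hf
        obtain ⟨x', y', hxy', h0', h1'⟩ := φ.arc_ends f hfE
        -- The ends of the earlier arc are vertices, which an open edge avoids; interior points are
        -- excluded by disjointness of open edges.
        rcases eq_or_ne s 0 with rfl | hs0
        · exact φ.arc_ne_point e hF.1 x' hxy'.left_mem t ht (by rw [← hs, h0'])
        rcases eq_or_ne s 1 with rfl | hs1
        · exact φ.arc_ne_point e hF.1 y' hxy'.right_mem t ht (by rw [← hs, h1'])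
        exact φ.arc_ne_arc e hF.1 f hfE hef t ht s
          ⟨unitInterval.pos_iff_ne_zero.2 hs0, unitInterval.lt_one_iff_ne_one.2 hs1⟩ hs.symm
  have := h2 hE.toFinset (by simp)
  rw [← ncard_eq_toFinset_card _ hE] at this
  simpa [image] using this

end Graph.TopEmbedding

/-! ### From the plane to the sphere -/

section Sphere

variable {M : Type*} [TopologicalSpace M]

/-- The inverse of a stereographic projection. -/
theorem exists_isOpenEmbedding_complex
    (h : M ≃ₜ Metric.sphere (0 : EuclideanSpace ℝ (Fin 3)) 1) (v : M) :
    ∃ i : ℂ → M, IsOpenEmbedding i ∧ range i = {v}ᶜ := by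
  have : Fact (Module.finrank ℝ (EuclideanSpace ℝ (Fin 3)) = 2 + 1) := ⟨by simp⟩
  let s := (stereographic' 2 (h v)).symm
  have hs : s.source = univ := stereographic'_target _
  have ht : s.target = {h v}ᶜ := stereographic'_source _
  let c : ℂ ≃ₜ EuclideanSpace ℝ (Fin 2) := Complex.orthonormalBasisOneI.repr.toHomeomorph
  refine ⟨h.symm ∘ s ∘ c, h.symm.isOpenEmbedding.comp
    ((s.isOpenEmbedding hs).comp c.isOpenEmbedding), ?_⟩
  have hr : range s = {h v}ᶜ := by
    rw [← ht, ← s.image_source_eq_target, hs, image_univ]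
  rw [range_comp, range_comp, c.range_coe, image_univ, hr, image_compl_eq h.symm.bijective,
    image_singleton, h.symm_apply_apply]

theorem nontrivial_of_homeomorph_sphere
    (h : M ≃ₜ Metric.sphere (0 : EuclideanSpace ℝ (Fin 3)) 1) : Nontrivial M := by
  obtain ⟨v⟩ : Nonempty (Metric.sphere (0 : EuclideanSpace ℝ (Fin 3)) 1) :=
    (NormedSpace.sphere_nonempty.2 zero_le_one).to_subtype
  obtain ⟨i, hi, -⟩ := exists_isOpenEmbedding_complex h (h.symm v)
  exact hi.injective.nontrivial

theorem exists_continuous_injective_complex_of_isOpen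
    (h : M ≃ₜ Metric.sphere (0 : EuclideanSpace ℝ (Fin 3)) 1) (O : Set M) (hO : IsOpen O)
    (hne : O.Nonempty) : ∃ k : ℂ → M, Continuous k ∧ Function.Injective k ∧ range k ⊆ O := by
  have := nontrivial_of_homeomorph_sphere h
  obtain ⟨x, hx⟩ := hne
  obtain ⟨v, hv⟩ := exists_ne x
  obtain ⟨i, hi, hr⟩ := exists_isOpenEmbedding_complex h v
  obtain ⟨z, rfl⟩ : x ∈ range i := hr ▸ hv.symm
  obtain ⟨k, hk, hinj, hkr⟩ := exists_continuous_injective_range_subset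
    (hO.preimage hi.continuous) ⟨z, hx⟩
  refine ⟨i ∘ k, hi.continuous.comp hk, hi.injective.comp hinj, ?_⟩
  rintro _ ⟨w, rfl⟩
  exact hkr ⟨w, rfl⟩

/-- Passing to the one-point compactification does not change the number of regions. -/
theorem regionCount_image [T2Space M] [CompactSpace M] {i : ℂ → M} (hi : IsOpenEmbedding i) {v : M}
    (hr : range i = {v}ᶜ) {S : Set ℂ} (hS : IsCompact S) :
    regionCount (i '' S) = regionCount S := by
  classical
  have hSc : IsClosed S := hS.isClosed
  have hmaps : MapsTo i Sᶜ (i '' S)ᶜ := by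
    rintro z hz ⟨w, hw, hwz⟩
    exact hz (hi.injective hwz ▸ hw)
  have hj : Continuous (hmaps.restrict i Sᶜ (i '' S)ᶜ) := hi.continuous.restrict hmaps
  obtain ⟨R, hR0, hR⟩ : ∃ R : ℝ, 0 ≤ R ∧ S ⊆ Metric.closedBall 0 R := by
    obtain ⟨R, hR⟩ := hS.isBounded.subset_closedBall 0
    exact ⟨max R 0, le_max_right _ _, hR.trans (Metric.closedBall_subset_closedBall (le_max_left _ _))⟩
  have hRS : (Metric.closedBall (0 : ℂ) R)ᶜ ⊆ Sᶜ := compl_subset_compl.2 hR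
  have hC := isPathConnected_compl_closedBall_zero hR0
  refine (ENat.card_congr (Equiv.ofBijective hj.connectedComponentsMap ⟨?_, ?_⟩)).symm
  · intro a b hab
    obtain ⟨p, rfl⟩ := ConnectedComponents.surjective_coe a
    obtain ⟨q, rfl⟩ := ConnectedComponents.surjective_coe b
    by_contra hne
    rw [ConnectedComponents.coe_eq_coe_iff_joinedIn hSc.isOpen_compl] at hne
    -- A bounded union of components of `Sᶜ` stays clopen in the sphere, since its union with `S` is
    -- compact. For distinct components, the first component or its complement in `Sᶜ` is bounded.
    have hsep : ∀ B : Set ℂ, IsOpen B → Bornology.IsBounded B → IsClosed (S ∪ B) → B ⊆ Sᶜ →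
        ∀ x y : ↥Sᶜ, (x : ℂ) ∈ B → (y : ℂ) ∉ B →
        ((hmaps.restrict i Sᶜ (i '' S)ᶜ x : ↥(i '' S)ᶜ) : ConnectedComponents ↥(i '' S)ᶜ) ≠
          hmaps.restrict i Sᶜ (i '' S)ᶜ y := by
      intro B hB hBb hBS hBd x y hx hy hxy
      have hopen : IsOpen ((Subtype.val : ↥(i '' S)ᶜ → M) ⁻¹' (i '' B)) :=
        (hi.isOpenMap B hB).preimage continuous_subtype_val
      have hcpt : IsCompact (S ∪ B) :=
        Metric.isCompact_of_isClosed_isBounded hBS (hS.isBounded.union hBb)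
      have hclosed : IsClosed ((Subtype.val : ↥(i '' S)ᶜ → M) ⁻¹' (i '' B)) := by
        have : (Subtype.val : ↥(i '' S)ᶜ → M) ⁻¹' (i '' B) = Subtype.val ⁻¹' (i '' (S ∪ B)) := by
          ext w
          simp only [mem_preimage, image_union, mem_union]
          exact ⟨Or.inr, fun h => h.resolve_left w.2⟩
        rw [this]
        exact ((hcpt.image hi.continuous).isClosed).preimage continuous_subtype_val
      rw [eq_comm, ConnectedComponents.coe_eq_coe'] at hxy
      have := IsClopen.connectedComponent_subset ⟨hclosed, hopen⟩
        (x := hmaps.restrict i Sᶜ (i '' S)ᶜ x) ⟨x, hx, rfl⟩ hxy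
      obtain ⟨w, hw, hwy⟩ := this
      exact hy (hi.injective hwy ▸ hw)
    let W := {z | JoinedIn Sᶜ (p : ℂ) z}
    have hWS : W ⊆ Sᶜ := fun z hz => hz.target_mem
    have hW : ∀ z ∈ W, ∀ w, JoinedIn Sᶜ z w → w ∈ W := fun z hz w hw => JoinedIn.trans hz hw
    have hVS : Sᶜ \ W ⊆ Sᶜ := sdiff_subset
    have hV : ∀ z ∈ Sᶜ \ W, ∀ w, JoinedIn Sᶜ z w → w ∈ Sᶜ \ W := fun z hz w hw =>
      ⟨hw.target_mem, fun h => hz.2 (JoinedIn.trans h hw.symm)⟩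
    have hWo := isOpen_of_joinedIn_saturated hSc hWS hW
    have hVo := isOpen_of_joinedIn_saturated hSc hVS hV
    have hSW : IsClosed (S ∪ W) := by
      rw [← isOpen_compl_iff, compl_union, ← sdiff_eq]
      exact hVo
    have hSV : IsClosed (S ∪ (Sᶜ \ W)) := by
      rw [← isOpen_compl_iff]
      convert hWo using 1
      ext z
      simp only [mem_compl_iff, mem_union, mem_sdiff, not_or, not_and, not_not]
      exact ⟨fun h => h.2 h.1, fun h => ⟨hWS h, fun _ => h⟩⟩
    have hpW : (p : ℂ) ∈ W := JoinedIn.refl p.2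
    by_cases hb : W ⊆ Metric.closedBall 0 R
    · exact hsep W hWo (Metric.isBounded_closedBall.subset hb) hSW hWS p q hpW hne hab
    · obtain ⟨w, hw, hwR⟩ := not_subset.1 hb
      have hVb : Sᶜ \ W ⊆ Metric.closedBall 0 R := by
        intro z hz
        by_contra hzR
        exact hz.2 (hW w hw z ((hC.joinedIn w hwR z hzR).mono hRS))
      exact hsep _ hVo (Metric.isBounded_closedBall.subset hVb) hSV hVS q p ⟨q.2, hne⟩
        (fun h => h.2 hpW) hab.symm
  · intro c
    obtain ⟨⟨y, hy⟩, rfl⟩ := ConnectedComponents.surjective_coe c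
    by_cases hyv : y = v
    · subst hyv
      obtain ⟨z, hz⟩ := hC.nonempty
      refine ⟨((⟨z, hRS hz⟩ : ↥Sᶜ) : ConnectedComponents ↥Sᶜ), ?_⟩
      -- The added point adheres to the outer region: otherwise it would be isolated, the range of
      -- `i` closed in a compact space, and the plane compact.
      have hycl : y ∈ closure (i '' (Metric.closedBall (0 : ℂ) R)ᶜ) := by
        by_contra hncl
        have hK : IsClosed (i '' Metric.closedBall (0 : ℂ) R) :=
          ((isCompact_closedBall 0 R).image hi.continuous).isClosed
        have hop : IsOpen ({y} : Set M) := by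
          convert isClosed_closure.isOpen_compl.inter hK.isOpen_compl using 1
          refine Subset.antisymm ?_ ?_
          · rw [singleton_subset_iff]
            refine ⟨hncl, ?_⟩
            rintro ⟨w, -, hw⟩
            have : y ∈ range i := ⟨w, hw⟩
            rw [hr] at this
            exact this rfl
          · rintro w ⟨hw1, hw2⟩
            by_contra hwy
            obtain ⟨u, rfl⟩ : w ∈ range i := hr ▸ hwy
            by_cases hu : u ∈ Metric.closedBall (0 : ℂ) R
            · exact hw2 ⟨u, hu, rfl⟩
            · exact hw1 (subset_closure ⟨u, hu, rfl⟩)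
        have hcl : IsClosed (range i) := hr ▸ hop.isClosed_compl
        have := (⟨hi.isEmbedding, hcl⟩ : IsClosedEmbedding i).compactSpace
        exact noncompact_univ ℂ isCompact_univ
      have hT : IsPreconnected (insert y (i '' (Metric.closedBall (0 : ℂ) R)ᶜ)) :=
        (hC.isConnected.isPreconnected.image i hi.continuous.continuousOn).subset_closure
          (subset_insert _ _) (insert_subset hycl subset_closure)
      have hTU : insert y (i '' (Metric.closedBall (0 : ℂ) R)ᶜ) ⊆ (i '' S)ᶜ :=
        insert_subset hy (by
          rintro _ ⟨w, hw, rfl⟩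
          exact hmaps (hRS hw))
      have hT' : IsPreconnected ((Subtype.val : ↥(i '' S)ᶜ → M) ⁻¹'
          insert y (i '' (Metric.closedBall (0 : ℂ) R)ᶜ)) := by
        rw [← IsInducing.subtypeVal.isPreconnected_image, Subtype.image_preimage_coe,
          inter_eq_self_of_subset_right hTU]
        exact hT
      exact ConnectedComponents.coe_eq_coe'.2 (hT'.subset_connectedComponent
        (Or.inl rfl : (⟨y, hy⟩ : ↥(i '' S)ᶜ) ∈ _) (Or.inr ⟨z, hz, rfl⟩))
    · obtain ⟨z, rfl⟩ : y ∈ range i := hr ▸ hyv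
      exact ⟨((⟨z, fun h => hy ⟨z, h, rfl⟩⟩ : ↥Sᶜ) : ConnectedComponents ↥Sᶜ), rfl⟩

end Sphere

/-! ### Euler's formula for graphs embedded in the sphere -/

namespace Graph.TopEmbedding

variable {α β M : Type*} [TopologicalSpace M] {G : Graph α β}

theorem range_arc_subset_image (φ : G.TopEmbedding M) {e : β} (he : e ∈ E(G)) :
    range (φ.arc e) ⊆ φ.image := fun _ hx =>
  Or.inr (mem_biUnion he hx)

theorem point_mem_image (φ : G.TopEmbedding M) {x : α} (hx : x ∈ V(G)) : φ.point x ∈ φ.image :=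
  Or.inl (mem_image_of_mem _ hx)

/-- A finite union of closed sets with empty interior has empty interior. This supplies the point
from which to project. -/
theorem exists_notMem_image (h : M ≃ₜ Metric.sphere (0 : EuclideanSpace ℝ (Fin 3)) 1)
    (φ : G.TopEmbedding M) (hV : V(G).Finite) (hE : E(G).Finite) : ∃ v, v ∉ φ.image := by
  classical
  have := h.symm.t2Space
  have hM := exists_continuous_injective_complex_of_isOpen h
  have hpt : interior (φ.point '' V(G)) = ∅ := by
    by_contra hne
    obtain ⟨k, -, hinj, hr⟩ := hM _ isOpen_interior (nonempty_iff_ne_empty.2 hne)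
    exact (infinite_range_of_injective hinj) ((hV.image _).subset (hr.trans interior_subset))
  have hind : ∀ F : Finset β, (F : Set β) ⊆ E(G) →
      IsClosed (φ.point '' V(G) ∪ ⋃ e ∈ (F : Set β), range (φ.arc e)) ∧
      interior (φ.point '' V(G) ∪ ⋃ e ∈ (F : Set β), range (φ.arc e)) = ∅ := by
    intro F
    induction F using Finset.induction_on with
    | empty => simpa [hpt] using (hV.image _).isClosed
    | insert e F he ih =>
      intro hF
      rw [Finset.coe_insert, insert_subset_iff] at hF
      obtain ⟨hc, hi⟩ := ih hF.2
      rw [Finset.coe_insert, biUnion_insert, union_comm (range _), ← union_assoc]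
      exact ⟨hc.union (isCompact_range (φ.arc e).continuous).isClosed, by
        rw [interior_union_isClosed_of_interior_empty hc
          (interior_range_arc_eq_empty hM (φ.arc_injOn e hF.1)), hi]⟩
  have hint := (hind hE.toFinset (by simp)).2
  by_contra! hall
  have himg : φ.image = univ := eq_univ_of_forall hall
  rw [hE.coe_toFinset] at hint
  change interior φ.image = ∅ at hint
  rw [himg, interior_univ] at hint
  have := nontrivial_of_homeomorph_sphere h
  exact univ_nonempty.ne_empty hint

theorem exists_lift (φ : G.TopEmbedding M) {i : ℂ → M} (hi : IsOpenEmbedding i)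
    (hr : φ.image ⊆ range i) : ∃ ψ : G.TopEmbedding ℂ, φ.image = i '' ψ.image := by
  have hp : ∀ x, ∃ z, x ∈ V(G) → i z = φ.point x := by
    intro x
    by_cases hx : x ∈ V(G)
    · obtain ⟨z, hz⟩ := hr (φ.point_mem_image hx)
      exact ⟨z, fun _ => hz⟩
    · exact ⟨0, fun h => absurd h hx⟩
  have ha : ∀ e, ∃ c : C(I, ℂ), e ∈ E(G) → ∀ t, i (c t) = φ.arc e t := by
    intro e
    by_cases he : e ∈ E(G)
    · have hmem : ∀ t, φ.arc e t ∈ range i := fun t => hr (φ.range_arc_subset_image he ⟨t, rfl⟩)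
      refine ⟨⟨fun t => hi.isEmbedding.toHomeomorph.symm ⟨φ.arc e t, hmem t⟩, by fun_prop⟩,
        fun _ t => ?_⟩
      exact congrArg Subtype.val (hi.isEmbedding.toHomeomorph.apply_symm_apply ⟨φ.arc e t, hmem t⟩)
    · exact ⟨.const _ 0, fun h => absurd h he⟩
  choose point hpoint using hp
  choose arc harc using ha
  refine ⟨⟨point, arc, ?_, ?_, ?_, ?_, ?_⟩, ?_⟩
  · intro x hx y hy hxy
    exact φ.point_injOn hx hy (by rw [← hpoint x hx, ← hpoint y hy, hxy])
  · intro e he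
    obtain ⟨x, y, hxy, h0, h1⟩ := φ.arc_ends e he
    refine ⟨x, y, hxy, hi.injective ?_, hi.injective ?_⟩
    · rw [harc e he, hpoint x hxy.left_mem, h0]
    · rw [harc e he, hpoint y hxy.right_mem, h1]
  · intro e he s hs t ht hst
    exact φ.arc_injOn e he hs ht (by rw [← harc e he, ← harc e he, hst])
  · intro e he x hx t ht hst
    exact φ.arc_ne_point e he x hx t ht (by rw [← harc e he, ← hpoint x hx, hst])
  · intro e he f hf hef s hs t ht hst
    exact φ.arc_ne_arc e he f hf hef s hs t ht (by rw [← harc e he, ← harc f hf, hst])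
  · simp only [image, image_union, image_iUnion, image_image]
    congr 1
    · exact (image_congr fun x hx => hpoint x hx).symm
    · refine iUnion₂_congr fun e he => ?_
      rw [← range_comp]
      exact congrArg range (funext fun t => (harc e he t).symm)

/-- If every vertex is adjacent to `u`, then every embedding has a connected image. -/
theorem isPreconnected_image (φ : G.TopEmbedding M) {u : α}
    (hadj : ∀ x ∈ V(G), x ≠ u → ∃ e, G.IsLink e u x) : IsPreconnected φ.image := by
  have hends : ∀ {e x y}, G.IsLink e x y → φ.point x ∈ range (φ.arc e) := by
    intro e x y h
    obtain ⟨a, b, hab, h0, h1⟩ := φ.arc_ends e h.edge_mem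
    rcases h.left_eq_or_eq hab with rfl | rfl
    · exact ⟨0, h0⟩
    · exact ⟨1, h1⟩
  have harc : ∀ e, IsPreconnected (range (φ.arc e)) := fun e =>
    isPreconnected_range (φ.arc e).continuous
  have hpt : ∀ x ∈ V(G), ∃ T ⊆ φ.image, φ.point u ∈ T ∧ φ.point x ∈ T ∧ IsPreconnected T := by
    intro x hx
    by_cases hxu : x = u
    · subst hxu
      exact ⟨{φ.point x}, by simpa using φ.point_mem_image hx, rfl, rfl, isPreconnected_singleton⟩
    · obtain ⟨e, he⟩ := hadj x hx hxu
      exact ⟨range (φ.arc e), φ.range_arc_subset_image he.edge_mem, hends he, hends he.symm, harc e⟩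
  refine isPreconnected_of_forall (φ.point u) ?_
  rintro y (⟨x, hx, rfl⟩ | hy)
  · exact hpt x hx
  · simp only [mem_iUnion] at hy
    obtain ⟨e, he, hy⟩ := hy
    obtain ⟨x, z, hxz⟩ := exists_isLink_of_mem_edgeSet he
    obtain ⟨T, hT, huT, hxT, hTc⟩ := hpt x hxz.left_mem
    exact ⟨T ∪ range (φ.arc e), union_subset hT (φ.range_arc_subset_image he), Or.inl huT, Or.inr hy,
      hTc.union _ hxT (hends hxz) (harc e)⟩

/-- Euler's formula on the sphere: `c` is the number of components of the image. -/
theorem exists_card_region_add (h : M ≃ₜ Metric.sphere (0 : EuclideanSpace ℝ (Fin 3)) 1)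
    (φ : G.TopEmbedding M) (hV : V(G).Finite) (hE : E(G).Finite) :
    ∃ c : ℕ, (V(G) = ∅ → c = 0) ∧ (V(G).Nonempty → 1 ≤ c) ∧
      (V(G).Nonempty → IsPreconnected φ.image → c = 1) ∧
      ENat.card φ.Region + V(G).ncard = 1 + c + E(G).ncard := by
  have := h.symm.t2Space
  have := h.symm.compactSpace
  obtain ⟨v, hv⟩ := φ.exists_notMem_image h hV hE
  obtain ⟨i, hi, hr⟩ := exists_isOpenEmbedding_complex h v
  obtain ⟨ψ, hψ⟩ := φ.exists_lift hi (by rwa [hr, subset_compl_singleton_iff])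
  obtain ⟨P, hX, -, hP, hd, hU, hc⟩ := ψ.exists_eulerRelation hV hE
  refine ⟨P.card, fun h0 => ?_, ?_, ?_, ?_⟩
  · rw [Finset.card_eq_zero, Finset.eq_empty_iff_forall_notMem]
    intro s hs
    obtain ⟨z, hz⟩ := (hP s hs).2.nonempty
    rcases (hU ▸ mem_sUnion_of_mem hz hs : z ∈ ψ.image) with ⟨x, hx, -⟩ | hz
    · simp [h0] at hx
    · simp only [mem_iUnion] at hz
      obtain ⟨e, he, -⟩ := hz
      obtain ⟨x, y, hxy⟩ := exists_isLink_of_mem_edgeSet he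
      simpa [h0] using hxy.left_mem
  · rintro ⟨x, hx⟩
    obtain ⟨s, hs, -⟩ := mem_sUnion.1 (hU ▸ ψ.point_mem_image hx : ψ.point x ∈ ⋃₀ (P : Set (Set ℂ)))
    exact Finset.card_pos.2 ⟨s, hs⟩
  · rintro ⟨x, hx⟩ hconn
    have hxU : ψ.point x ∈ ⋃₀ (P : Set (Set ℂ)) := hU ▸ ψ.point_mem_image hx
    obtain ⟨s, hs, hxs⟩ := mem_sUnion.1 hxU
    rw [hψ, hi.isInducing.isPreconnected_image, ← hU] at hconn
    rw [Finset.card_eq_one]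
    refine ⟨s, Finset.eq_singleton_iff_unique_mem.2 ⟨hs, fun t ht => ?_⟩⟩
    -- A second piece would split the connected image into two disjoint nonempty closed sets.
    by_contra hne
    obtain ⟨y, hy⟩ := (hP t ht).2.nonempty
    have hT : IsClosed (⋃₀ (P \ {s} : Set (Set ℂ))) := by
      rw [sUnion_eq_biUnion]
      exact (P.finite_toSet.sdiff).isClosed_biUnion fun a ha => (hP a ha.1).1
    have hST : Disjoint s (⋃₀ (P \ {s} : Set (Set ℂ))) :=
      disjoint_sUnion_right.2 fun a ha => hd hs ha.1 (Ne.symm ha.2)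
    obtain ⟨w, -, hws, hwT⟩ := isPreconnected_closed_iff.1 hconn s _ (hP s hs).1 hT (by
      rintro w ⟨a, ha, hwa⟩
      by_cases has : a = s
      · exact Or.inl (has ▸ hwa)
      · exact Or.inr ⟨a, ⟨ha, has⟩, hwa⟩) ⟨_, hxU, hxs⟩
      ⟨y, mem_sUnion_of_mem hy ht, mem_sUnion_of_mem hy ⟨ht, hne⟩⟩
    exact hST.le_bot ⟨hws, hwT⟩
  · rw [← hc, ← regionCount_image hi hr hX, ← hψ]
    rfl

end Graph.TopEmbedding

/-! ### Degrees and identification of the graphs -/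

namespace Graph

variable {α β M : Type*} [TopologicalSpace M] {G : Graph α β}

section Degree

open Classical in
/-- The contribution of an edge to the degree of a vertex. -/
noncomputable def incidenceWeight (G : Graph α β) (e : β) (x : α) : ℕ :=
  (if G.Inc e x then 1 else 0) + (if G.IsLoopAt e x then 1 else 0)

theorem IsLoopAt.incidenceWeight_eq {e : β} {x : α} (h : G.IsLoopAt e x) :
    G.incidenceWeight e x = 2 := by
  simp [incidenceWeight, h, h.inc]

theorem IsLoopAt.incidenceWeight_eq_zero {e : β} {x y : α} (h : G.IsLoopAt e x) (hxy : x ≠ y) :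
    G.incidenceWeight e y = 0 := by
  have h1 : ¬ G.Inc e y := fun h' => hxy (h.eq_of_inc h')
  have h2 : ¬ G.IsLoopAt e y := fun h' => h1 h'.inc
  simp [incidenceWeight, h1, h2]

theorem IsLink.incidenceWeight_eq {e : β} {x y : α} (h : G.IsLink e x y) (hxy : x ≠ y) :
    G.incidenceWeight e x = 1 := by
  have h2 : ¬ G.IsLoopAt e x := fun h' => hxy (h'.eq_of_inc h.inc_right)
  simp [incidenceWeight, h.inc_left, h2]

theorem vertexDegree_eq_sum (F : Finset β) (hF : E(G) = F) (x : α) :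
    G.vertexDegree x = (∑ e ∈ F, G.incidenceWeight e x : ℕ) := by
  classical
  have h1 : {e | G.Inc e x} = (F.filter fun e => G.Inc e x : Finset β) := by
    ext e
    have : G.Inc e x → e ∈ F := fun h => by
      have := h.edge_mem
      rwa [hF] at this
    simpa using this
  have h2 : {e | G.IsLoopAt e x} = (F.filter fun e => G.IsLoopAt e x : Finset β) := by
    ext e
    have : G.IsLoopAt e x → e ∈ F := fun h => by
      have := h.edge_mem
      rwa [hF] at this
    simpa using this
  simp only [vertexDegree, h1, h2, encard_coe_eq_coe_finsetCard, incidenceWeight,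
    Finset.sum_add_distrib, Finset.sum_boole, Nat.cast_add, Nat.cast_id]

/-- The handshake lemma. -/
theorem sum_vertexDegree (W : Finset α) (hW : V(G) = W) (F : Finset β) (hF : E(G) = F) :
    ∑ x ∈ W, ∑ e ∈ F, G.incidenceWeight e x = 2 * F.card := by
  classical
  rw [Finset.sum_comm, mul_comm, ← smul_eq_mul]
  refine Finset.sum_eq_card_nsmul fun e he => ?_
  obtain ⟨a, b, hab⟩ := exists_isLink_of_mem_edgeSet (hF.symm ▸ he : e ∈ E(G))
  have ha : a ∈ W := by simpa [hW] using hab.left_mem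
  have hb : b ∈ W := by simpa [hW] using hab.right_mem
  rcases eq_or_ne a b with rfl | hne
  · have hl : G.IsLoopAt e a := hab
    rw [Finset.sum_eq_single_of_mem a ha fun y _ hy => hl.incidenceWeight_eq_zero hy.symm,
      hl.incidenceWeight_eq]
  · rw [Finset.sum_eq_add_of_mem a b ha hb hne, hab.incidenceWeight_eq hne,
      hab.symm.incidenceWeight_eq hne.symm]
    rintro y - ⟨hya, hyb⟩
    have h1 : ¬ G.Inc e y := fun h => (h.eq_or_eq_of_isLink hab).elim hya hyb
    have h2 : ¬ G.IsLoopAt e y := fun h => h1 h.inc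
    simp [incidenceWeight, h1, h2]

theorem three_mul_ncard_le (hV : V(G).Finite) (hE : E(G).Finite)
    (h : ∀ x ∈ V(G), 3 ≤ G.vertexDegree x) : 3 * V(G).ncard ≤ 2 * E(G).ncard := by
  rw [ncard_eq_toFinset_card _ hV, ncard_eq_toFinset_card _ hE,
    ← sum_vertexDegree (G := G) hV.toFinset (by simp) hE.toFinset (by simp), mul_comm, ← smul_eq_mul]
  refine Finset.card_nsmul_le_sum _ _ _ fun x hx => ?_
  have := h x (by simpa using hx)
  rw [vertexDegree_eq_sum hE.toFinset (by simp)] at this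
  exact_mod_cast this

/-- An edge of a graph with vertex set `{u, v}`. -/
theorem isLink_or_isLoopAt {u v : α} (huv : u ≠ v) (hV : V(G) = {u, v}) {e : β} (he : e ∈ E(G)) :
    (G.IsLink e u v ∧ G.incidenceWeight e u = 1 ∧ G.incidenceWeight e v = 1) ∨
    (G.IsLoopAt e u ∧ G.incidenceWeight e u = 2 ∧ G.incidenceWeight e v = 0) ∨
    (G.IsLoopAt e v ∧ G.incidenceWeight e u = 0 ∧ G.incidenceWeight e v = 2) := by
  have hlink : ∀ {e}, G.IsLink e u v → (G.IsLink e u v ∧ G.incidenceWeight e u = 1 ∧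
      G.incidenceWeight e v = 1) := fun h =>
    ⟨h, h.incidenceWeight_eq huv, h.symm.incidenceWeight_eq huv.symm⟩
  obtain ⟨x, y, hxy⟩ := exists_isLink_of_mem_edgeSet he
  have hx := hxy.left_mem
  have hy := hxy.right_mem
  rw [hV, mem_insert_iff, mem_singleton_iff] at hx hy
  rcases hx with hx | hx <;> rcases hy with hy | hy <;> rw [hx, hy] at hxy
  · have hl : G.IsLoopAt e u := hxy
    exact Or.inr (Or.inl ⟨hxy, hl.incidenceWeight_eq, hl.incidenceWeight_eq_zero huv⟩)
  · exact Or.inl (hlink hxy)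
  · exact Or.inl (hlink hxy.symm)
  · have hl : G.IsLoopAt e v := hxy
    exact Or.inr (Or.inr ⟨hxy, hl.incidenceWeight_eq_zero huv.symm, hl.incidenceWeight_eq⟩)

theorem isThetaGraph_or_isBifocal (hV : V(G).ncard = 2) (hE : E(G).ncard = 3)
    (h : ∀ x ∈ V(G), 3 ≤ G.vertexDegree x) : G.IsThetaGraph ∨ G.IsBifocal := by
  classical
  obtain ⟨u, v, huv, hV⟩ := ncard_eq_two.1 hV
  obtain ⟨e, f, g, hef, heg, hfg, hE⟩ := ncard_eq_three.1 hE
  have hdeg : ∀ x ∈ V(G), 3 ≤ G.incidenceWeight e x + G.incidenceWeight f x +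
      G.incidenceWeight g x := by
    intro x hx
    have := h x hx
    rw [vertexDegree_eq_sum {e, f, g} (by simpa using hE), Finset.sum_insert (by simp [hef, heg]),
      Finset.sum_pair hfg] at this
    rw [add_assoc]
    exact_mod_cast this
  have hu := hdeg u (by simp [hV])
  have hv := hdeg v (by simp [hV])
  have hbif : ∀ e f g : β, E(G) = {e, f, g} → e ≠ f → e ≠ g → f ≠ g → G.IsLoopAt e u →
      G.IsLoopAt f v → G.IsLink g u v → G.IsBifocal := fun e f g hE hef heg hfg h1 h2 h3 =>
    ⟨u, v, huv, hV, e, f, g, hef, heg, hfg, hE, h1, h2, h3⟩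
  -- All orderings of the edges are needed, since any of them may be the bridge or either loop of
  -- the bifocal.
  have h1 : E(G) = {e, g, f} := by rw [hE, pair_comm f g]
  have h2 : E(G) = {f, e, g} := by rw [hE, insert_comm]
  have h3 : E(G) = {f, g, e} := by rw [h2, pair_comm e g]
  have h4 : E(G) = {g, e, f} := by rw [h1, insert_comm]
  have h5 : E(G) = {g, f, e} := by rw [h4, pair_comm e f]
  rcases isLink_or_isLoopAt huv hV (e := e) (by simp [hE]) with ⟨he, he1, he2⟩ | ⟨he, he1, he2⟩ |
    ⟨he, he1, he2⟩ <;>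
  rcases isLink_or_isLoopAt huv hV (e := f) (by simp [hE]) with ⟨hf, hf1, hf2⟩ | ⟨hf, hf1, hf2⟩ |
    ⟨hf, hf1, hf2⟩ <;>
  rcases isLink_or_isLoopAt huv hV (e := g) (by simp [hE]) with ⟨hg, hg1, hg2⟩ | ⟨hg, hg1, hg2⟩ |
    ⟨hg, hg1, hg2⟩ <;>
  -- Of the 27 type patterns, the degree bounds leave three links, or one link and a loop at each
  -- vertex.
  first
  | (exfalso; omega)
  | exact Or.inl ⟨u, v, huv, hV, e, f, g, hef, heg, hfg, hE, he, hf, hg⟩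
  | exact Or.inr (hbif e f g hE hef heg hfg he hf hg)
  | exact Or.inr (hbif e g f h1 heg hef hfg.symm he hg hf)
  | exact Or.inr (hbif f e g h2 hef.symm hfg heg hf he hg)
  | exact Or.inr (hbif f g e h3 hfg hef.symm heg.symm hf hg he)
  | exact Or.inr (hbif g e f h4 heg.symm hfg.symm hef hg he hf)
  | exact Or.inr (hbif g f e h5 hfg.symm heg.symm hef.symm hg hf he)

theorem isFigureEight_of_ncard (hV : V(G).ncard = 1) (hE : E(G).ncard = 2) : G.IsFigureEight := by
  obtain ⟨v, hV⟩ := ncard_eq_one.1 hV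
  obtain ⟨e, f, hef, hE⟩ := ncard_eq_two.1 hE
  have hloop : ∀ e ∈ E(G), G.IsLoopAt e v := by
    intro e he
    obtain ⟨x, y, hxy⟩ := exists_isLink_of_mem_edgeSet he
    have hx : x = v := by simpa [hV] using hxy.left_mem
    have hy : y = v := by simpa [hV] using hxy.right_mem
    subst hx hy
    exact hxy
  exact ⟨v, hV, e, f, hef, hE, hloop e (by simp [hE]), hloop f (by simp [hE])⟩

theorem IsThetaGraph.three_le_vertexDegree (h : G.IsThetaGraph) :
    ∀ x ∈ V(G), 3 ≤ G.vertexDegree x := by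
  classical
  obtain ⟨u, v, huv, hV, e, f, g, hef, heg, hfg, hE, he, hf, hg⟩ := h
  intro x hx
  rw [vertexDegree_eq_sum {e, f, g} (by simpa using hE), Finset.sum_insert (by simp [hef, heg]),
    Finset.sum_pair hfg]
  rw [hV] at hx
  rcases hx with rfl | rfl
  · simp [he.incidenceWeight_eq huv, hf.incidenceWeight_eq huv, hg.incidenceWeight_eq huv]
  · simp [he.symm.incidenceWeight_eq huv.symm, hf.symm.incidenceWeight_eq huv.symm,
      hg.symm.incidenceWeight_eq huv.symm]

theorem IsFigureEight.three_le_vertexDegree (h : G.IsFigureEight) :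
    ∀ x ∈ V(G), 3 ≤ G.vertexDegree x := by
  classical
  obtain ⟨v, hV, e, f, hef, hE, he, hf⟩ := h
  intro x hx
  rw [hV, mem_singleton_iff] at hx
  subst hx
  rw [vertexDegree_eq_sum {e, f} (by simpa using hE), Finset.sum_pair hef, he.incidenceWeight_eq,
    hf.incidenceWeight_eq]
  norm_num

theorem IsBifocal.three_le_vertexDegree (h : G.IsBifocal) :
    ∀ x ∈ V(G), 3 ≤ G.vertexDegree x := by
  classical
  obtain ⟨u, v, huv, hV, e, f, g, hef, heg, hfg, hE, he, hf, hg⟩ := h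
  intro x hx
  rw [vertexDegree_eq_sum {e, f, g} (by simpa using hE), Finset.sum_insert (by simp [hef, heg]),
    Finset.sum_pair hfg]
  rw [hV] at hx
  rcases hx with rfl | rfl
  · simp [he.incidenceWeight_eq, hf.incidenceWeight_eq_zero huv.symm, hg.incidenceWeight_eq huv]
  · simp [he.incidenceWeight_eq_zero huv, hf.incidenceWeight_eq,
      hg.symm.incidenceWeight_eq huv.symm]

end Degree

/-! ### Explicit plane drawings -/

section Existence

/-- The image of an embedding under an injective continuous map. -/
def TopEmbedding.map {N : Type*} [TopologicalSpace N] (ψ : G.TopEmbedding N) (i : C(N, M))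
    (hi : Function.Injective i) : G.TopEmbedding M where
  point x := i (ψ.point x)
  arc e := i.comp (ψ.arc e)
  point_injOn _ hx _ hy hxy := ψ.point_injOn hx hy (hi hxy)
  arc_ends e he := by
    obtain ⟨x, y, hxy, h0, h1⟩ := ψ.arc_ends e he
    exact ⟨x, y, hxy, congrArg i h0, congrArg i h1⟩
  arc_injOn e he _ hs _ ht hst := ψ.arc_injOn e he hs ht (hi hst)
  arc_ne_point e he x hx t ht h := ψ.arc_ne_point e he x hx t ht (hi h)
  arc_ne_arc e he f hf hef s hs t ht h := ψ.arc_ne_arc e he f hf hef s hs t ht (hi h)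

/-- A simple closed curve through the origin in the right half plane. -/
noncomputable def loopArc : C(I, ℂ) :=
  ⟨fun t => ⟨t * (1 - t), t * (1 - t) * (2 * t - 1)⟩, by
    have : (fun t : I => (⟨t * (1 - t), t * (1 - t) * (2 * t - 1)⟩ : ℂ)) = fun t : I =>
        (((t : ℝ) * (1 - t) : ℝ) : ℂ) + ((t * (1 - t) * (2 * t - 1) : ℝ) : ℂ) * Complex.I := by
      ext t
      exact Complex.mk_eq_add_mul_I _ _
    rw [this]
    fun_prop⟩

/-- A parabolic arc from `-1` to `1` of height determined by `k`. -/
noncomputable def parabolicArc (k : ℝ) : C(I, ℂ) :=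
  ⟨fun t => ⟨2 * t - 1, k * (t * (1 - t))⟩, by
    have : (fun t : I => (⟨2 * t - 1, k * (t * (1 - t))⟩ : ℂ)) = fun t : I =>
        ((2 * (t : ℝ) - 1 : ℝ) : ℂ) + ((k * (t * (1 - t)) : ℝ) : ℂ) * Complex.I := by
      ext t
      exact Complex.mk_eq_add_mul_I _ _
    rw [this]
    fun_prop⟩

theorem loopArc_re_pos {t : I} (ht : t ∈ Ioo (0 : I) 1) : 0 < (loopArc t).re := by
  have h0 : (0 : ℝ) < t := ht.1
  have h1 : (t : ℝ) < 1 := ht.2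
  exact mul_pos h0 (by linarith)

theorem loopArc_zero : loopArc 0 = 0 := by
  apply Complex.ext <;> simp [loopArc]

theorem loopArc_one : loopArc 1 = 0 := by
  apply Complex.ext <;> simp [loopArc]

theorem loopArc_injOn : InjOn loopArc (Ioo 0 1) := by
  intro s hs t ht hst
  have h0 := (loopArc_re_pos hs).ne'
  have h1 : (s : ℝ) * (1 - s) = t * (1 - t) := congrArg Complex.re hst
  have h2 : (s : ℝ) * (1 - s) * (2 * s - 1) = t * (1 - t) * (2 * t - 1) := congrArg Complex.im hst
  rw [← h1] at h2
  -- The quotient of imaginary by real part is `2t - 1`, which recovers the parameter.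
  have h3 := mul_left_cancel₀ h0 h2
  exact Subtype.ext (by linarith)

theorem parabolicArc_zero (k : ℝ) : parabolicArc k 0 = -1 := by
  apply Complex.ext <;> simp [parabolicArc]

theorem parabolicArc_one (k : ℝ) : parabolicArc k 1 = 1 := by
  apply Complex.ext <;> simp [parabolicArc]
  norm_num

theorem parabolicArc_re (k : ℝ) (t : I) : (parabolicArc k t).re = 2 * t - 1 := rfl

theorem parabolicArc_re_mem (k : ℝ) {t : I} (ht : t ∈ Ioo (0 : I) 1) :
    (parabolicArc k t).re ∈ Ioo (-1 : ℝ) 1 := by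
  have h0 : (0 : ℝ) < t := ht.1
  have h1 : (t : ℝ) < 1 := ht.2
  rw [parabolicArc_re]
  constructor <;> linarith

theorem parabolicArc_injective (k : ℝ) : Function.Injective (parabolicArc k) := by
  intro s t hst
  have h : (2 * s - 1 : ℝ) = 2 * t - 1 := congrArg Complex.re hst
  exact Subtype.ext (by linarith)

theorem parabolicArc_ne {k l : ℝ} (hkl : k ≠ l) {s t : I} (hs : s ∈ Ioo (0 : I) 1) :
    parabolicArc k s ≠ parabolicArc l t := by
  intro h
  have h1 : (2 * s - 1 : ℝ) = 2 * t - 1 := congrArg Complex.re h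
  have h2 : k * ((s : ℝ) * (1 - s)) = l * (t * (1 - t)) := congrArg Complex.im h
  have h3 : (s : ℝ) = t := by linarith
  rw [← h3] at h2
  -- `loopArc_re_pos` is used only for `s (1 - s) > 0`, that product being the real part of `loopArc
  -- s`.
  exact hkl (mul_right_cancel₀ (loopArc_re_pos hs).ne' h2)

theorem IsThetaGraph.nonempty_topEmbedding (h : G.IsThetaGraph) : Nonempty (G.TopEmbedding ℂ) := by
  classical
  obtain ⟨u, v, huv, hV, e, f, g, hef, heg, hfg, hE, he, hf, hg⟩ := h
  -- Three parabolas of different heights over the segment from -1 to 1 meet only at its ends.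
  let k : β → ℝ := fun b => if b = e then 0 else if b = f then 1 else 2
  have hk : InjOn k E(G) := by
    rw [hE]
    rintro a (rfl | rfl | rfl) b (rfl | rfl | rfl) <;> simp [k, hef, heg, hfg, hef.symm, heg.symm, hfg.symm]
  let pt : α → ℂ := fun x => if x = u then -1 else 1
  have hpu : pt u = -1 := by simp [pt]
  have hpv : pt v = 1 := by simp [pt, huv.symm]
  refine ⟨⟨pt, fun b => parabolicArc (k b), ?_, ?_, fun b _ => (parabolicArc_injective _).injOn, ?_,
    fun a ha b hb hab s hs t ht => parabolicArc_ne (hk.ne ha hb hab) hs⟩⟩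
  · rw [hV]
    rintro a (rfl | rfl) b (rfl | rfl) hab
    · rfl
    · rw [hpu, hpv] at hab
      norm_num at hab
    · rw [hpu, hpv] at hab
      norm_num at hab
    · rfl
  · intro b hb
    rw [hE] at hb
    rw [parabolicArc_zero, parabolicArc_one]
    refine ⟨u, v, ?_, hpu.symm, hpv.symm⟩
    rcases hb with rfl | rfl | rfl
    exacts [he, hf, hg]
  · intro b _ x hx t ht h
    have h1 := parabolicArc_re_mem (k b) ht
    rw [h] at h1
    rw [hV] at hx
    rcases hx with rfl | rfl
    · simp [hpu] at h1
    · simp [hpv] at h1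

theorem IsFigureEight.nonempty_topEmbedding (h : G.IsFigureEight) :
    Nonempty (G.TopEmbedding ℂ) := by
  classical
  obtain ⟨v, hV, e, f, hef, hE, he, hf⟩ := h
  -- The two loops lie in opposite half planes, meeting only at the origin.
  let arc : β → C(I, ℂ) := fun b => if b = e then loopArc else -loopArc
  have hae : arc e = loopArc := if_pos rfl
  have haf : arc f = -loopArc := if_neg hef.symm
  have hne : ∀ s ∈ Ioo (0 : I) 1, ∀ t ∈ Ioo (0 : I) 1, loopArc s ≠ -loopArc t := by
    intro s hs t ht h
    have h1 := loopArc_re_pos hs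
    have h2 := loopArc_re_pos ht
    rw [h, Complex.neg_re] at h1
    linarith
  refine ⟨⟨fun _ => 0, arc, ?_, ?_, ?_, ?_, ?_⟩⟩
  · rw [hV]
    exact injOn_singleton _ _
  · intro b hb
    rw [hE] at hb
    refine ⟨v, v, ?_⟩
    rcases hb with rfl | rfl
    · exact ⟨he, by rw [hae, loopArc_zero], by rw [hae, loopArc_one]⟩
    · exact ⟨hf, by rw [haf]; simp [loopArc_zero], by rw [haf]; simp [loopArc_one]⟩
  · intro b hb
    rw [hE] at hb
    rcases hb with rfl | rfl
    · rw [hae]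
      exact loopArc_injOn
    · rw [haf]
      exact fun s hs t ht hst => loopArc_injOn hs ht (neg_injective hst)
  · intro b hb x _ t ht h
    have h1 := loopArc_re_pos ht
    rw [hE] at hb
    rcases hb with rfl | rfl
    · rw [hae] at h
      simp [h] at h1
    · rw [haf] at h
      have h' : loopArc t = 0 := neg_eq_zero.1 h
      simp [h'] at h1
  · intro a ha b hb hab s hs t ht
    rw [hE] at ha hb
    rcases ha with rfl | rfl <;> rcases hb with rfl | rfl
    · exact absurd rfl hab
    · rw [hae, haf]
      exact hne s hs t ht
    · rw [hae, haf]
      exact (hne t ht s hs).symm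
    · exact absurd rfl hab

theorem IsBifocal.nonempty_topEmbedding (h : G.IsBifocal) : Nonempty (G.TopEmbedding ℂ) := by
  classical
  obtain ⟨u, v, huv, hV, e, f, g, hef, heg, hfg, hE, he, hf, hg⟩ := h
  -- The open edges lie in the disjoint strips `re < -1`, `re > 1` and `-1 < re < 1`; the vertices
  -- sit on the dividing lines.
  let arc : β → C(I, ℂ) := fun b =>
    if b = e then .const I (-1) - loopArc else if b = f then .const I 1 + loopArc
    else parabolicArc 0
  have hae : ∀ t, arc e t = -1 - loopArc t := fun t => by simp [arc]
  have haf : ∀ t, arc f t = 1 + loopArc t := fun t => by simp [arc, hef.symm]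
  have hag : ∀ t, arc g t = parabolicArc 0 t := fun t => by simp [arc, heg.symm, hfg.symm]
  have hre : ∀ t ∈ Ioo (0 : I) 1, (arc e t).re < -1 := fun t ht => by
    rw [hae, Complex.sub_re]
    simpa using loopArc_re_pos ht
  have hrf : ∀ t ∈ Ioo (0 : I) 1, 1 < (arc f t).re := fun t ht => by
    rw [haf, Complex.add_re]
    simpa using loopArc_re_pos ht
  have hrg : ∀ t ∈ Ioo (0 : I) 1, (arc g t).re ∈ Ioo (-1 : ℝ) 1 := fun t ht => by
    rw [hag]
    exact parabolicArc_re_mem 0 ht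
  let pt : α → ℂ := fun x => if x = u then -1 else 1
  have hpu : pt u = -1 := by simp [pt]
  have hpv : pt v = 1 := by simp [pt, huv.symm]
  refine ⟨⟨pt, arc, ?_, ?_, ?_, ?_, ?_⟩⟩
  · rw [hV]
    rintro a (rfl | rfl) b (rfl | rfl) hab
    · rfl
    · rw [hpu, hpv] at hab
      norm_num at hab
    · rw [hpu, hpv] at hab
      norm_num at hab
    · rfl
  · intro b hb
    rw [hE] at hb
    rcases hb with rfl | rfl | rfl
    · exact ⟨u, u, he, by rw [hae, hpu, loopArc_zero, sub_zero], by
        rw [hae, hpu, loopArc_one, sub_zero]⟩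
    · exact ⟨v, v, hf, by rw [haf, hpv, loopArc_zero, add_zero], by
        rw [haf, hpv, loopArc_one, add_zero]⟩
    · exact ⟨u, v, hg, by rw [hag, hpu, parabolicArc_zero], by rw [hag, hpv, parabolicArc_one]⟩
  · intro b hb s hs t ht hst
    rw [hE] at hb
    rcases hb with rfl | rfl | rfl
    · rw [hae, hae] at hst
      exact loopArc_injOn hs ht (sub_right_injective hst)
    · rw [haf, haf] at hst
      exact loopArc_injOn hs ht (add_right_injective _ hst)
    · rw [hag, hag] at hst
      exact parabolicArc_injective 0 hst
  · intro b hb x hx t ht h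
    have hx' : (pt x).re = -1 ∨ (pt x).re = 1 := by
      rw [hV] at hx
      rcases hx with rfl | rfl
      · exact Or.inl (by simp [hpu])
      · exact Or.inr (by simp [hpv])
    rw [← h] at hx'
    rw [hE] at hb
    rcases hb with rfl | rfl | rfl
    · have := hre t ht
      rcases hx' with h | h <;> linarith
    · have := hrf t ht
      rcases hx' with h | h <;> linarith
    · have := hrg t ht
      rcases hx' with h | h <;> linarith [this.1, this.2]
  · intro a ha b hb hab s hs t ht hst
    have h1 := hre s hs
    have h2 := hrf s hs
    have h3 := hrg s hs
    have h1' := hre t ht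
    have h2' := hrf t ht
    have h3' := hrg t ht
    rw [hE] at ha hb
    have hst' := congrArg Complex.re hst
    rcases ha with rfl | rfl | rfl <;> rcases hb with rfl | rfl | rfl <;>
      first
      | exact hab rfl
      | linarith [h3.1, h3.2, h3'.1, h3'.2]

end Existence

/-! ### The classification -/

theorem IsThetaGraph.exists_star (h : G.IsThetaGraph) :
    (V(G).ncard = 2 ∧ E(G).ncard = 3) ∧ ∃ u ∈ V(G), ∀ x ∈ V(G), x ≠ u → ∃ e, G.IsLink e u x := by
  obtain ⟨u, v, huv, hV, e, f, g, hef, heg, hfg, hE, he, hf, hg⟩ := h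
  refine ⟨⟨hV ▸ ncard_pair huv, ncard_eq_three.2 ⟨e, f, g, hef, heg, hfg, hE⟩⟩, u, by simp [hV], ?_⟩
  rw [hV]
  rintro x (rfl | rfl) hx
  · exact absurd rfl hx
  · exact ⟨e, he⟩

theorem IsFigureEight.exists_star (h : G.IsFigureEight) :
    (V(G).ncard = 1 ∧ E(G).ncard = 2) ∧ ∃ u ∈ V(G), ∀ x ∈ V(G), x ≠ u → ∃ e, G.IsLink e u x := by
  obtain ⟨v, hV, e, f, hef, hE, he, hf⟩ := h
  refine ⟨⟨hV ▸ ncard_singleton v, hE ▸ ncard_pair hef⟩, v, by simp [hV], ?_⟩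
  rw [hV]
  rintro x rfl hx
  exact absurd rfl hx

theorem IsBifocal.exists_star (h : G.IsBifocal) :
    (V(G).ncard = 2 ∧ E(G).ncard = 3) ∧ ∃ u ∈ V(G), ∀ x ∈ V(G), x ≠ u → ∃ e, G.IsLink e u x := by
  obtain ⟨u, v, huv, hV, e, f, g, hef, heg, hfg, hE, he, hf, hg⟩ := h
  refine ⟨⟨hV ▸ ncard_pair huv, ncard_eq_three.2 ⟨e, f, g, hef, heg, hfg, hE⟩⟩, u, by simp [hV], ?_⟩
  rw [hV]
  rintro x (rfl | rfl) hx
  · exact absurd rfl hx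
  · exact ⟨g, hg⟩

/-- The star at `u` makes the image connected, so Euler's formula reads `R + n = 1 + 1 + (n + 1)`.
-/
theorem TopEmbedding.partitionsInto_three
    (h : M ≃ₜ Metric.sphere (0 : EuclideanSpace ℝ (Fin 3)) 1) {n : ℕ} (hn : n ≠ 0)
    (hG : (V(G).ncard = n ∧ E(G).ncard = n + 1) ∧
      ∃ u ∈ V(G), ∀ x ∈ V(G), x ≠ u → ∃ e, G.IsLink e u x)
    (φ : G.TopEmbedding M) : φ.PartitionsInto 3 := by
  obtain ⟨⟨hV, hE⟩, u, hu, hadj⟩ := hG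
  obtain ⟨c, -, -, hc, heul⟩ := φ.exists_card_region_add h
    (finite_of_ncard_ne_zero (hV ▸ hn)) (finite_of_ncard_ne_zero (by omega))
  rw [hc ⟨u, hu⟩ (φ.isPreconnected_image hadj), hV, hE] at heul
  refine ENat.add_left_injective_of_ne_top (ENat.natCast_ne_top n) ?_
  refine heul.trans ?_
  push_cast
  ring

theorem isThetaGraph_or_of_partitionsInto_three
    (h : M ≃ₜ Metric.sphere (0 : EuclideanSpace ℝ (Fin 3)) 1) (hV : V(G).Finite) (hE : E(G).Finite)
    (hdeg : ∀ x ∈ V(G), 3 ≤ G.vertexDegree x) (φ : G.TopEmbedding M) (hφ : φ.PartitionsInto 3) :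
    G.IsThetaGraph ∨ G.IsFigureEight ∨ G.IsBifocal := by
  obtain ⟨c, hc0, hc1, -, heul⟩ := φ.exists_card_region_add h hV hE
  rw [show ENat.card φ.Region = (3 : ℕ) from hφ] at heul
  have heul' : 3 + V(G).ncard = 1 + c + E(G).ncard := by exact_mod_cast heul
  have hle := three_mul_ncard_le hV hE hdeg
  -- The empty graph has `c = 0` and one region, so it is excluded separately; otherwise `c ≥ 1`.
  rcases V(G).eq_empty_or_nonempty with h0 | hne
  · have hE0 : E(G) = ∅ := by
      rw [eq_empty_iff_forall_notMem]
      intro e he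
      obtain ⟨x, y, hxy⟩ := exists_isLink_of_mem_edgeSet he
      simpa [h0] using hxy.left_mem
    rw [h0, hE0, hc0 h0] at heul'
    simp at heul'
  · have hc := hc1 hne
    -- From `E = V + 2 - c ≤ V + 1` and `3V ≤ 2E` follows `V ≤ 2`. Connectedness need not be
    -- assumed.
    have hpos : 0 < V(G).ncard := (ncard_pos hV).2 hne
    obtain ⟨h1, h2⟩ | ⟨h1, h2⟩ : (V(G).ncard = 1 ∧ E(G).ncard = 2) ∨
      (V(G).ncard = 2 ∧ E(G).ncard = 3) := by omega
    · exact Or.inr (Or.inl (isFigureEight_of_ncard h1 h2))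
    · exact (isThetaGraph_or_isBifocal h1 h2 hdeg).imp_right Or.inr

end Graph

theorem mainTheorem10 {α β M : Type*} [TopologicalSpace M]
    (hM : Nonempty (M ≃ₜ Metric.sphere (0 : EuclideanSpace ℝ (Fin 3)) 1)) (G : Graph α β) :
    ((V(G).Finite ∧ E(G).Finite ∧ (∀ x ∈ V(G), 3 ≤ G.vertexDegree x) ∧
        ∃ φ : G.TopEmbedding M, φ.PartitionsInto 3) ↔
      (G.IsThetaGraph ∨ G.IsFigureEight ∨ G.IsBifocal)) ∧
    ((G.IsThetaGraph ∨ G.IsFigureEight ∨ G.IsBifocal) →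
      ∀ φ : G.TopEmbedding M, φ.PartitionsInto 3) := by
  obtain ⟨h⟩ := hM
  have hall : (G.IsThetaGraph ∨ G.IsFigureEight ∨ G.IsBifocal) →
      ∀ φ : G.TopEmbedding M, φ.PartitionsInto 3 := by
    rintro (hG | hG | hG) φ
    · exact φ.partitionsInto_three h two_ne_zero hG.exists_star
    · exact φ.partitionsInto_three h one_ne_zero hG.exists_star
    · exact φ.partitionsInto_three h two_ne_zero hG.exists_star
  refine ⟨⟨?_, fun hG => ?_⟩, hall⟩
  · rintro ⟨hV, hE, hdeg, φ, hφ⟩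
    exact Graph.isThetaGraph_or_of_partitionsInto_three h hV hE hdeg φ hφ
  · have := nontrivial_of_homeomorph_sphere h
    -- A plane drawing is carried into `M` by an inverse stereographic projection; any centre will
    -- do.
    obtain ⟨v, -⟩ := exists_pair_ne M
    obtain ⟨i, hi, -⟩ := exists_isOpenEmbedding_complex h v
    have hex : Nonempty (G.TopEmbedding ℂ) := by
      rcases hG with hG | hG | hG
      exacts [hG.nonempty_topEmbedding, hG.nonempty_topEmbedding, hG.nonempty_topEmbedding]
    obtain ⟨ψ⟩ := hex
    have hfin : V(G).ncard ≠ 0 ∧ E(G).ncard ≠ 0 ∧ ∀ x ∈ V(G), 3 ≤ G.vertexDegree x := by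
      rcases hG with hG | hG | hG
      · obtain ⟨⟨h1, h2⟩, -⟩ := hG.exists_star
        exact ⟨by omega, by omega, hG.three_le_vertexDegree⟩
      · obtain ⟨⟨h1, h2⟩, -⟩ := hG.exists_star
        exact ⟨by omega, by omega, hG.three_le_vertexDegree⟩
      · obtain ⟨⟨h1, h2⟩, -⟩ := hG.exists_star
        exact ⟨by omega, by omega, hG.three_le_vertexDegree⟩
    exact ⟨finite_of_ncard_ne_zero hfin.1, finite_of_ncard_ne_zero hfin.2.1, hfin.2.2,
      ψ.map ⟨i, hi.continuous⟩ hi.injective, hall hG _⟩
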